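/- Let $(\Omega,\mathcal F,\mathbf P)$ be a probability space and let $\tilde f_i:\mathbf R\times\Omega\to[0,\infty)$, $i\in\mathbf Z$, be independent and identically distributed random functions, i.e. i.i.d. random elements of a measurable space of non-negative functions on $\mathbf R$ on which the evaluation $(h,y)\mapsto h(y)$ is jointly measurable; assume that $y\mapsto\tilde f_0(y,\omega)$ is locally bounded for almost every $\omega$. Assume that for some $\tilde\lambda>0$ $$\tilde\beta:=\sup_{n\in\mathbf Z}\mathbf E\sup_{n-\frac12<y\le n+\frac12}\exp\{\tilde\lambda\tilde f_0(y,\omega)\}<\infty ,$$ where the expectation of a possibly non-measurable function means the infimum of the expectations of all random variables dominating it. Put $$p(l,m):=\frac1{1-e^{-l}}+\frac1{1-e^{l-m}},\qquad W(F):=\sup_{\mu>\tilde\lambda}\frac1\mu\Big(\tilde\lambda(F-2)-\log p(\tilde\lambda,\mu)-\log\tilde\beta\Big).$$ Then $W$, which depends on $\tilde\lambda$ and $\tilde\beta$ only, is a non-decreasing function from $[0,\infty)$ to $[0,\infty)$ that is not identically zero. Moreover, let $F\ge0$ and suppose that, for almost every $\omega$, the system $$\frac{d}{dt}u_i(t)=\Big(u_{i-1}(t)+u_{i+1}(t)-2u_i(t)-\tilde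 f_i(u_i(t),\omega)+F\Big)^+,\qquad u_i(0)=0,\qquad i\in\mathbf Z,\ t\ge0,$$ has a unique solution $(u_i)_{i\in\mathbf Z}$, which depends measurably on $\omega$ for each $t\ge0$. Here a solution is a family of locally absolutely continuous functions satisfying the integrated equation, and $\dot u_i(t)$ denotes the right-hand side of the equation at time $t$. Then $\dot u_0(t)$ and $u_0(t)$ are integrable for every $t\ge 0$, $$\mathbf E\,\dot u_0(t)\ge W(F)\quad\text{for all }t\ge0,\qquad\text{and}\qquad \mathbf E\,\frac{u_0(t)}t\ge W(F)\quad\text{for all }t>0 .$$ The first inequality also holds, at every $t\ge0$ at which the right derivative of $u_0$ exists almost surely, with that derivative (which is then integrable) in place of $\dot u_0(t)$. -/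

import Mathlib

open MeasureTheory ProbabilityTheory Set
open scoped ENNReal

noncomputable section

namespace FrontModel

/-- The right-hand side
`(v_{i-1}(t) + v_{i+1}(t) - 2 v_i(t) - h_i(v_i(t)) + F)^+` of the evolution equation,
for a deterministic environment `h` and a family `v` of height functions. -/
def velocity (F : ℝ) (h : ℤ → ℝ → ℝ) (v : ℤ → ℝ → ℝ) (i : ℤ) (t : ℝ) : ℝ :=
  max (v (i - 1) t + v (i + 1) t - 2 * v i t - h i (v i t) + F) 0

/-- `v` solves `dv_i/dt = (v_{i-1} + v_{i+1} - 2 v_i - h_i(v_i) + F)^+`, `v_i(0) = 0`, on `[0, ∞)`.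
As `h_i` need not be continuous, the equation is read in the integrated (Carathéodory) sense: each
`v_i` is locally absolutely continuous with derivative equal to the right-hand side at almost every
time. For continuous `h_i` this is the classical notion. Only times `t ≥ 0` play a role. -/
structure IsSolution (F : ℝ) (h : ℤ → ℝ → ℝ) (v : ℤ → ℝ → ℝ) : Prop where
  initial : ∀ i, v i 0 = 0
  integrable : ∀ i, ∀ t, 0 ≤ t → IntervalIntegrable (velocity F h v i) volume 0 t
  integral_eq : ∀ i, ∀ t, 0 ≤ t → v i t = ∫ s in (0 : ℝ)..t, velocity F h v i s

/-- `v` is the unique solution (uniqueness is on `[0, ∞)`, the values at negative times being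
irrelevant). -/
def IsUniqueSolution (F : ℝ) (h : ℤ → ℝ → ℝ) (v : ℤ → ℝ → ℝ) : Prop :=
  IsSolution F h v ∧ ∀ v', IsSolution F h v' → ∀ i, ∀ t, 0 ≤ t → v' i t = v i t

/-- Outer expectation: the infimum of the expectations of all random variables dominating `g`. -/
def outerExpectation {Ω : Type*} [MeasurableSpace Ω] (P : Measure Ω) (g : Ω → ℝ≥0∞) : ℝ≥0∞ :=
  ⨅ (Z : Ω → ℝ≥0∞) (_ : Measurable Z) (_ : ∀ ω, g ω ≤ Z ω), ∫⁻ ω, Z ω ∂P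

/-- `sup_{n ∈ ℤ} E sup_{n - 1/2 < y ≤ n + 1/2} exp (lam * f y)` for a random function `f`. -/
def windowMoment {Ω : Type*} [MeasurableSpace Ω] (P : Measure Ω) (lam : ℝ) (f : Ω → ℝ → ℝ) :
    ℝ≥0∞ :=
  ⨆ n : ℤ, outerExpectation P fun ω =>
    ⨆ y ∈ Ioc ((n : ℝ) - 1 / 2) ((n : ℝ) + 1 / 2), ENNReal.ofReal (Real.exp (lam * f ω y))

/-- `p(l, m) = 1 / (1 - e^{-l}) + 1 / (1 - e^{l - m})`. -/
def p (l m : ℝ) : ℝ := 1 / (1 - Real.exp (-l)) + 1 / (1 - Real.exp (l - m))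

/-- `W(F) = sup_{μ > lam} (1/μ) (lam (F - 2) - log p(lam, μ) - log β)`. -/
def W (lam β F : ℝ) : ℝ :=
  ⨆ μ : Ioi lam,
    1 / (μ : ℝ) * (lam * (F - 2) - Real.log (p lam (μ : ℝ)) - Real.log β)

end FrontModel

end

noncomputable section

namespace FrontModel

open Filter Topology

/-! ### Measurable projections, from the universal measurability of analytic sets -/

section Projection

/-! Fix `t` and let `α` be the mean velocity at time `t`. Since the environment is i.i.d. and the
solution is unique, environment and heights are jointly stationary, so every site has mean velocity
`α`. Round the heights to integers. Rounding changes a second difference by less than `2`, so the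
velocity at a site is at least `max (D - g + F - 2) 0`, where `D` is the rounded second difference
and `g` is the supremum of the obstacle over the unit window around the rounded height.

Over `n` consecutive sites the sum of the `D` telescopes and is at least `-2M` once the rounded
heights lie in `[0, M]`. Hence `exp (-2 lam M - μ * total velocity)` is at most the product of the
weights `exp (lam * D - μ * max (D - g + F - 2) 0)` along the rounded path. That path depends on the
whole environment, but it can be replaced by the sum over all integer paths with starting heights in
`[0, M]`. For a deterministic path the weights at different sites are independent, and summing over
`D` costs a mean factor of at most `c = p(lam, μ) exp (-lam (F - 2)) β` per site
(`tsum_stepWeight_le`, `lintegral_prod_mul_branchSum_le`). Jensen's inequality gives `-2 lam M - μ n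
α ≤ 2 log (M + 1) + n log c`. Dividing by `n` and letting `n → ∞` yields `α ≥ -(log c) / μ`, and the
supremum over `μ` is `W`.

Two preparations carry this. The a priori bound `u_i(t) ≤ F t` supplies `M` (`ae_height_le`): a
barrier on a finite box, with stationarity controlling the boundary values in probability. The
measurable projection theorem supplies a stationary measurable version of the solution
(`exists_measurable_stationary_solution`) and measurable window suprema. -/

theorem isCompact_box (N : ℕ → ℕ) : IsCompact {x : ℕ → ℕ | ∀ i, x i ≤ N i} := by
  have h := isCompact_univ_pi (s := fun i => Iic (N i)) fun i => (finite_Iic (N i)).isCompact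
  convert h using 1
  ext y
  simp [Pi.le_def]

/-- An open set of `ℕ → ℕ` containing the compact box `∏ [0, N i]` contains a cylinder over one of
its finite-dimensional faces. -/
theorem exists_cylinder_subset_of_box_subset {N : ℕ → ℕ} {V : Set (ℕ → ℕ)} (hV : IsOpen V)
    (hK : {x : ℕ → ℕ | ∀ i, x i ≤ N i} ⊆ V) :
    ∃ k, {x : ℕ → ℕ | ∀ i < k, x i ≤ N i} ⊆ V := by
  by_contra! hcon
  have hex : ∀ k, ∃ x : ℕ → ℕ, (∀ i < k, x i ≤ N i) ∧ x ∉ V := fun k => by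
    obtain ⟨x, hx, hxV⟩ := not_subset.1 (hcon k)
    exact ⟨x, hx, hxV⟩
  choose x hx hxV using hex
  -- Truncating `x k` by `N` puts it in the compact box. Each fixed coordinate is unaffected once
  -- `k` exceeds it, so the untruncated subsequence has the same limit.
  obtain ⟨y, hyK, φ, hφ, hlim⟩ := (isCompact_box N).tendsto_subseq (x := fun k i => min (x k i) (N i))
    fun k i => min_le_right _ _
  have hx_lim : Tendsto (fun j => x (φ j)) atTop (𝓝 y) := by
    rw [tendsto_pi_nhds] at hlim ⊢
    intro i
    refine (hlim i).congr' ?_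
    filter_upwards [eventually_gt_atTop i] with j hj
    exact min_eq_left (hx _ i (hj.trans_le (hφ.id_le j)))
  obtain ⟨j, hj⟩ := (hx_lim.eventually (hV.mem_nhds (hK hyK))).exists
  exact hxV _ hj

/-- Inner regularity of finite Borel measures on analytic sets. -/
theorem _root_.MeasureTheory.AnalyticSet.exists_isCompact_le_measure {α : Type*}
    [TopologicalSpace α] [MeasurableSpace α] (μ : Measure α) [μ.OuterRegular] {s : Set α}
    (hs : AnalyticSet s) {c : ℝ≥0∞} (hc : c < μ s) :
    ∃ K ⊆ s, IsCompact K ∧ c ≤ μ K := by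
  rw [AnalyticSet] at hs
  rcases hs with rfl | ⟨g, hg, rfl⟩
  · simp at hc
  -- Increasing the bound on one further coordinate exhausts `B l`. Continuity along increasing
  -- unions holds for outer measure without measurability, so the bounds can be chosen one at a time
  -- with the image keeping measure above `c`.
  let B : List ℕ → Set (ℕ → ℕ) := fun l => {x | ∀ i (h : i < l.length), x i ≤ l[i]}
  have step : ∀ l : List ℕ, c < μ (g '' B l) → ∃ n, c < μ (g '' B (l ++ [n])) := by
    intro l hl
    have hU : g '' B l = ⋃ n, g '' B (l ++ [n]) := by
      rw [← image_iUnion]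
      congr 1
      ext x
      simp only [B, mem_ofPred_eq, mem_iUnion, List.length_append, List.length_singleton]
      constructor
      · intro hx
        refine ⟨x l.length, fun i hi => ?_⟩
        rcases Nat.lt_succ_iff_lt_or_eq.1 hi with h | rfl
        · rw [List.getElem_append_left h]
          exact hx i h
        · simp
      · rintro ⟨n, hx⟩ i hi
        have := hx i (by omega)
        rwa [List.getElem_append_left hi] at this
    have hmono : Monotone fun n => g '' B (l ++ [n]) := by
      intro m n hmn
      refine image_mono fun x hx i hi => ?_
      have h1 := hx i (by simpa using hi)
      refine h1.trans ?_
      rcases Nat.lt_succ_iff_lt_or_eq.1 (show i < l.length + 1 by simpa using hi) with h | rfl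
      · simp [List.getElem_append_left h]
      · simpa using hmn
    rw [hU, hmono.measure_iUnion] at hl
    exact lt_iSup_iff.1 hl
  choose! next hnext using step
  let L : ℕ → List ℕ := fun k => Nat.rec [] (fun _ l => l ++ [next l]) k
  have hLs : ∀ k, L (k + 1) = L k ++ [next (L k)] := fun k => rfl
  have hLlen : ∀ k, (L k).length = k := by
    intro k
    induction k with
    | zero => rfl
    | succ k ih => rw [hLs]; simp [ih]
  have hLc : ∀ k, c < μ (g '' B (L k)) := by
    intro k
    induction k with
    | zero =>
      have : B (L 0) = univ := by
        ext x
        simp [B, L]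
      rwa [this, image_univ]
    | succ k ih => exact hnext _ ih
  let N : ℕ → ℕ := fun k => next (L k)
  have hLget : ∀ k i (h : i < (L k).length), (L k)[i] = N i := by
    intro k
    induction k with
    | zero => intro i h; simp [L] at h
    | succ k ih =>
      intro i h
      have h' : i < k + 1 := (hLlen (k + 1)) ▸ h
      simp only [hLs]
      rcases Nat.lt_succ_iff_lt_or_eq.1 h' with h | rfl
      · rw [List.getElem_append_left (by rwa [hLlen])]
        exact ih i _
      · rw [List.getElem_append_right (by rw [hLlen])]
        simp [N]
  have hBL : ∀ k, B (L k) = {x | ∀ i < k, x i ≤ N i} := by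
    intro k
    ext x
    simp only [B, mem_ofPred_eq, hLget, hLlen]
  refine ⟨g '' {x | ∀ i, x i ≤ N i}, image_subset_range _ _, (isCompact_box N).image hg, ?_⟩
  -- By outer regularity only open supersets matter, and each contains the image of a whole cylinder
  -- `B (L k)`.
  rw [Set.measure_eq_iInf_isOpen]
  refine le_iInf₂ fun U hU => le_iInf fun hUo => ?_
  obtain ⟨k, hk⟩ := exists_cylinder_subset_of_box_subset (hUo.preimage hg) (image_subset_iff.1 hU)
  rw [← hBL] at hk
  exact (hLc k).le.trans (measure_mono (image_subset_iff.2 hk))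

/-- Analytic sets are universally measurable. -/
theorem _root_.MeasureTheory.AnalyticSet.nullMeasurableSet {α : Type*}
    [TopologicalSpace α] [T2Space α] [MeasurableSpace α] [OpensMeasurableSpace α]
    (μ : Measure α) [μ.OuterRegular] [IsFiniteMeasure μ] {s : Set α}
    (hs : AnalyticSet s) : NullMeasurableSet s μ := by
  have hK : ∀ c : Iio (μ s), ∃ K ⊆ s, IsCompact K ∧ (c : ℝ≥0∞) ≤ μ K :=
    fun c => hs.exists_isCompact_le_measure μ c.2
  rcases eq_or_ne (μ s) 0 with h0 | h0
  · exact NullMeasurableSet.of_null h0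
  obtain ⟨c, -, hc_lt, hc_lim⟩ := exists_seq_strictMono_tendsto' (pos_iff_ne_zero.2 h0)
  choose K hKs hKc hcK using fun n => hK ⟨c n, (hc_lt n).2⟩
  have hmeas : MeasurableSet (⋃ n, K n) := MeasurableSet.iUnion fun n => (hKc n).measurableSet
  refine hmeas.nullMeasurableSet.congr
    (ae_eq_of_subset_of_measure_ge (iUnion_subset hKs) ?_ hmeas.nullMeasurableSet
      (measure_ne_top μ s))
  exact le_of_tendsto' hc_lim fun n => (hcK n).trans (measure_mono (subset_iUnion K n))

/-- A measurable set of a product `X × Y` only involves countably many measurable sets of `X`. -/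
theorem exists_measurable_code {X Y : Type*} [MeasurableSpace X] [MeasurableSpace Y]
    {G : Set (X × Y)} (hG : MeasurableSet G) :
    ∃ (π : X → ℕ → Bool) (G' : Set ((ℕ → Bool) × Y)), Measurable π ∧ MeasurableSet G' ∧
      G = Prod.map π id ⁻¹' G' := by
  classical
  rw [← generateFrom_prod] at hG
  induction G, hG using MeasurableSpace.generateFrom_induction with
  | hC t ht _ =>
    obtain ⟨A, hA, B, hB, rfl⟩ := ht
    refine ⟨fun x _ => decide (x ∈ A), {c : ℕ → Bool | c 0 = true} ×ˢ B, ?_, ?_, ?_⟩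
    · refine measurable_pi_lambda _ fun _ => ?_
      exact measurable_to_bool (by simpa [preimage] using hA)
    · refine MeasurableSet.prod ?_ hB
      exact measurable_pi_apply (X := fun _ : ℕ => Bool) 0 (measurableSet_singleton true)
    · ext ⟨x, y⟩
      simp
  | empty => exact ⟨fun _ _ => true, ∅, measurable_const, MeasurableSet.empty, by simp⟩
  | compl t _ ih =>
    obtain ⟨π, G', hπ, hG', rfl⟩ := ih
    exact ⟨π, G'ᶜ, hπ, hG'.compl, rfl⟩
  | iUnion s _ ih =>
    choose π G' hπ hG' heq using ih
    -- Countably many codes are interleaved into one by the pairing bijection; `r n` recovers the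
    -- `n`-th.
    let r : ℕ → (ℕ → Bool) → ℕ → Bool := fun n c j => c (Nat.pair n j)
    have hr : ∀ n, Measurable (r n) := fun n =>
      measurable_pi_lambda _ fun j => measurable_pi_apply _
    refine ⟨fun x m => π m.unpair.1 x m.unpair.2, ⋃ n, Prod.map (r n) id ⁻¹' G' n, ?_, ?_, ?_⟩
    · exact measurable_pi_lambda _ fun m => (measurable_pi_apply _).comp (hπ _)
    · exact MeasurableSet.iUnion fun n => ((hr n).prodMap measurable_id) (hG' n)
    · ext ⟨x, y⟩
      simp only [mem_iUnion, mem_preimage, Prod.map_apply, id_eq]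
      refine exists_congr fun n => ?_
      rw [heq n]
      simp [r]

/-- **Measurable projection theorem.** -/
theorem nullMeasurableSet_image_fst {X Y : Type*} [MeasurableSpace X] [MeasurableSpace Y]
    [StandardBorelSpace Y] (μ : Measure X) [IsFiniteMeasure μ] {G : Set (X × Y)}
    (hG : MeasurableSet G) : NullMeasurableSet (Prod.fst '' G) μ := by
  obtain ⟨π, G', hπ, hG', rfl⟩ := exists_measurable_code hG
  have himage : Prod.fst '' (Prod.map π id ⁻¹' G') = π ⁻¹' (Prod.fst '' G') := by
    ext x
    simp
  rw [himage]
  let := TopologicalSpace.metrizableSpaceMetric (ℕ → Bool)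
  have hA : AnalyticSet (Prod.fst '' G') := hG'.analyticSet_image measurable_fst
  exact (hA.nullMeasurableSet (μ.map π)).preimage
    (hπ.measurePreserving μ).quasiMeasurePreserving

end Projection

/-! ### Deterministic properties of solutions -/

section Deterministic

variable {F : ℝ} {h : ℤ → ℝ → ℝ} {v v' : ℤ → ℝ → ℝ}

theorem velocity_nonneg (i : ℤ) (t : ℝ) : 0 ≤ velocity F h v i t := le_max_right _ _

theorem velocity_congr {t : ℝ} (hv : ∀ i, v i t = v' i t) (i : ℤ) :
    velocity F h v i t = velocity F h v' i t := by
  simp only [velocity, hv]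

/-- Translation of a family indexed by `ℤ`. -/
def translate {α : Type*} (j : ℤ) (x : ℤ → α) (i : ℤ) : α := x (i + j)

theorem velocity_translate (j i : ℤ) (t : ℝ) :
    velocity F (translate j h) (translate j v) i t = velocity F h v (i + j) t := by
  simp only [velocity, translate]
  rw [show i - 1 + j = i + j - 1 by ring, show i + 1 + j = i + j + 1 by ring]

theorem IsSolution.translate (hv : IsSolution F h v) (j : ℤ) :
    IsSolution F (translate j h) (translate j v) where
  initial i := hv.initial (i + j)
  integrable i t ht := by
    have : velocity F (FrontModel.translate j h) (FrontModel.translate j v) i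
      = velocity F h v (i + j) := funext fun t => velocity_translate j i t
    rw [this]
    exact hv.integrable (i + j) t ht
  integral_eq i t ht := by
    simp only [velocity_translate]
    exact hv.integral_eq (i + j) t ht

theorem IsSolution.congr (hv : IsSolution F h v) (hvv' : ∀ i t, 0 ≤ t → v i t = v' i t) :
    IsSolution F h v' := by
  have hvel : ∀ i s, 0 ≤ s → velocity F h v i s = velocity F h v' i s :=
    fun i s hs => velocity_congr (fun j => hvv' j s hs) i
  refine ⟨fun i => (hvv' i 0 le_rfl).symm.trans (hv.initial i), fun i t ht => ?_, fun i t ht => ?_⟩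
  · refine (hv.integrable i t ht).congr fun s hs => ?_
    rw [uIoc_of_le ht] at hs
    exact hvel i s hs.1.le
  · rw [← hvv' i t ht, hv.integral_eq i t ht]
    refine intervalIntegral.integral_congr fun s hs => ?_
    rw [uIcc_of_le ht] at hs
    exact hvel i s hs.1

theorem IsSolution.nonneg (hv : IsSolution F h v) (i : ℤ) {t : ℝ} (ht : 0 ≤ t) : 0 ≤ v i t := by
  rw [hv.integral_eq i t ht]
  exact intervalIntegral.integral_nonneg ht fun s _ => velocity_nonneg i s

theorem IsSolution.intervalIntegrable (hv : IsSolution F h v) (i : ℤ) {s t : ℝ} (hs : 0 ≤ s)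
    (ht : 0 ≤ t) : IntervalIntegrable (velocity F h v i) volume s t :=
  (hv.integrable i s hs).symm.trans (hv.integrable i t ht)

theorem IsSolution.sub_eq (hv : IsSolution F h v) (i : ℤ) {s t : ℝ} (hs : 0 ≤ s) (ht : 0 ≤ t) :
    v i t - v i s = ∫ r in s..t, velocity F h v i r := by
  rw [hv.integral_eq i t ht, hv.integral_eq i s hs,
    intervalIntegral.integral_interval_sub_left (hv.integrable i t ht) (hv.integrable i s hs)]

theorem IsSolution.monotoneOn (hv : IsSolution F h v) (i : ℤ) : MonotoneOn (v i) (Ici 0) := by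
  intro s hs t ht hst
  rw [← sub_nonneg, hv.sub_eq i hs ht]
  exact intervalIntegral.integral_nonneg hst fun r _ => velocity_nonneg i r

theorem IsSolution.continuousOn (hv : IsSolution F h v) (i : ℤ) : ContinuousOn (v i) (Ici 0) := by
  intro t ht
  have ht' : (0 : ℝ) ≤ t := ht
  have hprim : ContinuousOn (fun x => ∫ s in (0 : ℝ)..x, velocity F h v i s) (uIcc 0 (t + 1)) := by
    refine intervalIntegral.continuousOn_primitive_interval ?_
    rw [uIcc_of_le (by linarith), integrableOn_Icc_iff_integrableOn_Ioc,
      ← intervalIntegrable_iff_integrableOn_Ioc_of_le (by linarith)]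
    exact hv.integrable i _ (by linarith)
  rw [uIcc_of_le (by linarith)] at hprim
  have hcont : ContinuousOn (v i) (Icc 0 (t + 1)) :=
    hprim.congr fun s hs => hv.integral_eq i s hs.1
  refine (hcont t ⟨ht', by linarith⟩).mono_of_mem_nhdsWithin ?_
  rw [← Ici_inter_Iic]
  exact inter_mem_nhdsWithin _ (Iic_mem_nhds (by linarith))

theorem IsSolution.continuous_max (hv : IsSolution F h v) (i : ℤ) :
    Continuous fun t => v i (max t 0) :=
  (hv.continuousOn i).comp_continuous (by fun_prop) fun t => le_max_right t 0

/-- For measurable environments and continuous heights, it suffices to test the integrated equation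
at rational times, in terms of Lebesgue integrals of nonnegative functions. -/
theorem isSolution_iff_lintegral (hvc : ∀ i, Continuous (v i))
    (hvel : ∀ i, Measurable (velocity F h v i)) :
    IsSolution F h v ↔ ∀ i, ∀ q : ℚ, 0 ≤ (q : ℝ) → 0 ≤ v i q ∧
      ENNReal.ofReal (v i q) = ∫⁻ s in Ioc 0 (q : ℝ), ENNReal.ofReal (velocity F h v i s) := by
  constructor
  · intro hv i q hq
    refine ⟨hv.nonneg i hq, ?_⟩
    rw [hv.integral_eq i q hq, intervalIntegral.integral_of_le hq]
    refine ofReal_integral_eq_lintegral_ofReal ?_ (ae_of_all _ fun s => velocity_nonneg i s)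
    exact (intervalIntegrable_iff_integrableOn_Ioc_of_le hq).1 (hv.integrable i q hq)
  · intro H
    have hint : ∀ i, ∀ t, 0 ≤ t → IntervalIntegrable (velocity F h v i) volume 0 t := by
      intro i t ht
      obtain ⟨q, hq⟩ := exists_rat_gt t
      have hq0 : (0 : ℝ) ≤ q := ht.trans hq.le
      rw [intervalIntegrable_iff_integrableOn_Ioc_of_le ht]
      refine IntegrableOn.mono_set (t := Ioc 0 (q : ℝ)) ?_ (Ioc_subset_Ioc_right hq.le)
      refine ⟨(hvel i).aestronglyMeasurable, ?_⟩
      rw [hasFiniteIntegral_iff_ofReal (ae_of_all _ fun s => velocity_nonneg i s),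
        ← (H i q hq0).2]
      exact ENNReal.ofReal_lt_top
    have hrat : ∀ i, ∀ q : ℚ, 0 ≤ (q : ℝ) → v i q = ∫ s in (0 : ℝ)..q, velocity F h v i s := by
      intro i q hq
      rw [intervalIntegral.integral_of_le hq,
        integral_eq_lintegral_of_nonneg_ae (ae_of_all _ fun s => velocity_nonneg i s)
          (hvel i).aestronglyMeasurable, ← (H i q hq).2, ENNReal.toReal_ofReal (H i q hq).1]
    refine ⟨fun i => by simpa using hrat i 0 (by simp), hint, fun i t ht => ?_⟩
    -- Both sides of the equation are continuous in time, so the identity passes from rational times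
    -- to `t`.
    obtain ⟨q, -, hqt, hq⟩ := Real.exists_seq_rat_strictAnti_tendsto t
    have hprim : ContinuousOn (fun x => ∫ s in (0 : ℝ)..x, velocity F h v i s)
        (Icc 0 (t + 1)) := by
      rw [← uIcc_of_le (by linarith)]
      refine intervalIntegral.continuousOn_primitive_interval ?_
      rw [uIcc_of_le (by linarith), integrableOn_Icc_iff_integrableOn_Ioc,
        ← intervalIntegrable_iff_integrableOn_Ioc_of_le (by linarith)]
      exact hint i _ (by linarith)
    have h1 : Tendsto (fun n => v i (q n)) atTop (𝓝 (v i t)) :=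
      ((hvc i).tendsto t).comp hq
    have hqmem : ∀ᶠ n in atTop, (q n : ℝ) ∈ Icc 0 (t + 1) := by
      filter_upwards [hq.eventually (Iio_mem_nhds (show t < t + 1 by linarith))] with n hn
      exact ⟨ht.trans (hqt n).le, (mem_Iio.1 hn).le⟩
    have h2 : Tendsto (fun n => ∫ s in (0 : ℝ)..q n, velocity F h v i s) atTop
        (𝓝 (∫ s in (0 : ℝ)..t, velocity F h v i s)) :=
      (hprim t ⟨ht, by linarith⟩).tendsto.comp
        (tendsto_nhdsWithin_iff.2 ⟨hq, hqmem⟩)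
    refine tendsto_nhds_unique h1 (h2.congr fun n => ?_)
    exact (hrat i (q n) (ht.trans (hqt n).le)).symm

end Deterministic

/-! ### A measurable version of the solution, stationary jointly with the environment -/

section Measurability

instance : MeasurableSpace C(ℝ, ℝ) := borel _

instance : BorelSpace C(ℝ, ℝ) := ⟨rfl⟩

/-- Families of continuous height functions, a Polish space. -/
abbrev Heights := ℤ → C(ℝ, ℝ)

theorem measurable_eval_heights (i : ℤ) :
    Measurable fun q : Heights × ℝ => q.1 i q.2 := by
  have h : Measurable fun q : C(ℝ, ℝ) × ℝ => q.1 q.2 := continuous_eval.measurable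
  have hi : Measurable fun q : Heights × ℝ => q.1 i :=
    (measurable_pi_apply i).comp measurable_fst
  exact h.comp (hi.prodMk measurable_snd)

variable {E : Type*} {ev : E → ℝ → ℝ}

/-- Pairs of an environment and a solution, frozen at negative times. -/
def solutionGraph (F : ℝ) (ev : E → ℝ → ℝ) : Set ((ℤ → E) × Heights) :=
  {q | IsSolution F (fun i => ev (q.1 i)) (fun i t => q.2 i t) ∧ ∀ i t, t ≤ 0 → q.2 i t = 0}

theorem translate_mem_solutionGraph {F : ℝ} {q : (ℤ → E) × Heights}
    (hq : q ∈ solutionGraph F ev) (j : ℤ) :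
    (translate j q.1, translate j q.2) ∈ solutionGraph F ev :=
  ⟨hq.1.translate j, fun i t ht => hq.2 (i + j) t ht⟩

variable [MeasurableSpace E]

theorem measurable_velocity (hev : Measurable fun q : E × ℝ => ev q.1 q.2) (F : ℝ) (i : ℤ) :
    Measurable fun q : ((ℤ → E) × Heights) × ℝ =>
      velocity F (fun i => ev (q.1.1 i)) (fun i t => q.1.2 i t) i q.2 := by
  have hh : ∀ i, Measurable fun q : ((ℤ → E) × Heights) × ℝ => q.1.2 i q.2 := fun i =>
    (measurable_eval_heights i).comp ((measurable_snd.comp measurable_fst).prodMk measurable_snd)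
  have he : Measurable fun q : ((ℤ → E) × Heights) × ℝ => ev (q.1.1 i) (q.1.2 i q.2) :=
    hev.comp (Measurable.prodMk
      ((measurable_pi_apply i).comp (measurable_fst.comp measurable_fst)) (hh i))
  exact (((((hh (i - 1)).add (hh (i + 1))).sub ((hh i).const_mul 2)).sub he).add_const F).max
    measurable_const

/-- The integrated equation reduces to countably many identities between Lebesgue integrals that
depend measurably on the pair. Vanishing at nonpositive times is a closed condition on the heights.
-/
theorem measurableSet_solutionGraph (hev : Measurable fun q : E × ℝ => ev q.1 q.2) (F : ℝ) :
    MeasurableSet (solutionGraph F ev) := by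
  have hvel := measurable_velocity hev F
  have heval : ∀ (i : ℤ) (t : ℝ), Measurable fun q : (ℤ → E) × Heights => q.2 i t := fun i t =>
    (measurable_eval_heights i).comp (measurable_snd.prodMk measurable_const)
  have h1 : {q : (ℤ → E) × Heights | IsSolution F (fun i => ev (q.1 i)) (fun i t => q.2 i t)}
      = ⋂ i : ℤ, ⋂ r : ℚ, ⋂ _ : 0 ≤ (r : ℝ), {q : (ℤ → E) × Heights | 0 ≤ q.2 i r} ∩
        {q | ENNReal.ofReal (q.2 i r) = ∫⁻ s in Ioc 0 (r : ℝ), ENNReal.ofReal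
          (velocity F (fun i => ev (q.1 i)) (fun i t => q.2 i t) i s)} := by
    ext q
    have := isSolution_iff_lintegral (F := F) (h := fun i => ev (q.1 i))
      (v := fun i t => q.2 i t) (fun i => (q.2 i).continuous)
      fun i => (hvel i).comp measurable_prodMk_left
    simp only [mem_ofPred_eq, this, mem_iInter, mem_inter_iff]
  have h2 : {q : (ℤ → E) × Heights | ∀ i t, t ≤ 0 → q.2 i t = 0}
      = Prod.snd ⁻¹' ⋂ i : ℤ, ⋂ t : ℝ, ⋂ _ : t ≤ 0, {v : Heights | v i t = 0} := by
    ext q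
    simp
  have hcl : IsClosed (⋂ i : ℤ, ⋂ t : ℝ, ⋂ _ : t ≤ 0, {v : Heights | v i t = 0}) := by
    refine isClosed_iInter fun i => isClosed_iInter fun t => isClosed_iInter fun _ => ?_
    exact isClosed_eq ((continuous_eval_const t).comp (continuous_apply i)) continuous_const
  have hsplit : solutionGraph F ev
      = {q | IsSolution F (fun i => ev (q.1 i)) (fun i t => q.2 i t)} ∩
        {q | ∀ i t, t ≤ 0 → q.2 i t = 0} := rfl
  rw [hsplit, h1, h2]
  refine MeasurableSet.inter ?_ (measurable_snd hcl.measurableSet)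
  refine MeasurableSet.iInter fun i => MeasurableSet.iInter fun r => MeasurableSet.iInter fun _ =>
    (measurableSet_le measurable_const (heval i r)).inter (measurableSet_eq_fun
      (heval i r).ennreal_ofReal ?_)
  exact (hvel i).ennreal_ofReal.lintegral_prod_right'

theorem measurable_translate {α : Type*} [MeasurableSpace α] (j : ℤ) :
    Measurable (translate j : (ℤ → α) → ℤ → α) :=
  measurable_pi_lambda _ fun i => measurable_pi_apply (i + j)

variable {Ω : Type*} [MeasurableSpace Ω] {P : Measure Ω}

theorem identDistrib_translate {f : ℤ → Ω → E}
    (hf_indep : iIndepFun f P) (hf_ident : ∀ i, IdentDistrib (f i) (f 0) P P) (j : ℤ) :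
    IdentDistrib (fun ω i => f i ω) (fun ω => translate j fun i => f i ω) P P :=
  IdentDistrib.pi (Y := fun i => f (i + j)) (fun i => (hf_ident i).trans (hf_ident (i + j)).symm)
    hf_indep (hf_indep.precomp (add_left_injective j))

/-- The law of the environment together with the heights is invariant under translations. -/
def JointlyStationary (P : Measure Ω) (f : ℤ → Ω → E) (U : Ω → Heights) : Prop :=
  ∀ j, P.map (fun ω => (fun i => f i ω, U ω))
    = P.map fun ω => (translate j fun i => f i ω, translate j (U ω))

/-- The unique solution has a measurable version, which is stationary jointly with the environment:
both follow from the measurable projection theorem applied to the graph of the solution map. -/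
theorem exists_measurable_stationary_solution [IsProbabilityMeasure P]
    (hev : Measurable fun q : E × ℝ => ev q.1 q.2) {f : ℤ → Ω → E} (hf : ∀ i, Measurable (f i))
    (hf_indep : iIndepFun f P) (hf_ident : ∀ i, IdentDistrib (f i) (f 0) P P)
    {F : ℝ} {u : ℤ → ℝ → Ω → ℝ}
    (hu : ∀ᵐ ω ∂P, IsUniqueSolution F (fun i => ev (f i ω)) fun i t => u i t ω) :
    ∃ U : Ω → Heights, Measurable U ∧
      (∀ᵐ ω ∂P, IsSolution F (fun i => ev (f i ω)) (fun i t => U ω i t) ∧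
        ∀ i t, 0 ≤ t → u i t ω = U ω i t) ∧
      JointlyStationary P f U := by
  classical
  let fbar : Ω → ℤ → E := fun ω i => f i ω
  have hfbar : Measurable fbar := measurable_pi_lambda _ hf
  let ν := P.map fbar
  have : IsProbabilityMeasure ν := Measure.isProbabilityMeasure_map hfbar.aemeasurable
  -- The default value `0` is used only on a null set. Measurability of `u'` is not yet known.
  let u' : Ω → Heights := fun ω =>
    if hc : ∀ i, Continuous fun t => u i (max t 0) ω then fun i => ⟨_, hc i⟩ else 0
  have hgood : ∀ᵐ ω ∂P, (fbar ω, u' ω) ∈ solutionGraph F ev ∧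
      (∀ v, (fbar ω, v) ∈ solutionGraph F ev → v = u' ω) ∧
      ∀ i t, 0 ≤ t → u i t ω = u' ω i t := by
    filter_upwards [hu] with ω hω
    have hc : ∀ i, Continuous fun t => u i (max t 0) ω := hω.1.continuous_max
    have hu' : ∀ i t, u' ω i t = u i (max t 0) ω := fun i t => by
      simp only [u', dif_pos hc, ContinuousMap.coe_mk]
    have hpos : ∀ i t, 0 ≤ t → u i t ω = u' ω i t := fun i t ht => by
      rw [hu', max_eq_left ht]
    have hneg : ∀ i t, t ≤ 0 → u' ω i t = 0 := fun i t ht => by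
      rw [hu', max_eq_right ht]
      exact hω.1.initial i
    refine ⟨⟨hω.1.congr hpos, hneg⟩, fun v hv => ?_, hpos⟩
    funext i
    ext t
    rcases le_total t 0 with ht | ht
    · rw [hneg i t ht]
      exact hv.2 i t ht
    · rw [← hpos i t ht]
      exact hω.2 _ hv.1 i t ht
  -- Environments having some solution for which the pair lies in `R`. By uniqueness, membership of
  -- the random pair in `R` becomes an event about the environment alone.
  let A : Set ((ℤ → E) × Heights) → Set (ℤ → E) := fun R => Prod.fst '' (solutionGraph F ev ∩ R)
  have hA : ∀ R, MeasurableSet R → NullMeasurableSet (A R) ν := fun R hR =>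
    nullMeasurableSet_image_fst ν ((measurableSet_solutionGraph hev F).inter hR)
  have hAiff : ∀ᵐ ω ∂P, ∀ R j, (translate j (fbar ω), translate j (u' ω)) ∈ R ↔
      translate j (fbar ω) ∈ A R := by
    filter_upwards [hgood] with ω hω R j
    constructor
    · intro hR
      exact ⟨_, ⟨translate_mem_solutionGraph hω.1 j, hR⟩, rfl⟩
    · rintro ⟨⟨e, v⟩, ⟨hG, hR⟩, rfl : e = _⟩
      -- Uniqueness is available for `fbar ω` only, so the competitor is translated back before
      -- comparison.
      have hback := translate_mem_solutionGraph hG (-j)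
      have he : translate (-j) (translate j (fbar ω)) = fbar ω := by
        funext i
        simp [translate]
      simp only [he] at hback
      have hv : v = translate j (u' ω) := by
        rw [← hω.2.1 _ hback]
        funext i
        simp [translate]
      rwa [← hv]
  have hmp : ∀ j, MeasurePreserving (fun ω => translate j (fbar ω)) P ν := fun j =>
    ⟨(measurable_translate j).comp hfbar, (identDistrib_translate hf_indep hf_ident j).map_eq.symm⟩
  have hnull : NullMeasurable u' P := by
    intro B hB
    have hB' : MeasurableSet (univ ×ˢ B : Set ((ℤ → E) × Heights)) := MeasurableSet.univ.prod hB
    refine ((hA _ hB').preimage (hmp 0).quasiMeasurePreserving).congr ?_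
    filter_upwards [hAiff] with ω hω
    have := hω (univ ×ˢ B) 0
    refine propext (Iff.trans this.symm ?_)
    have h0 : translate 0 (u' ω) = u' ω := by
      funext i
      simp [translate]
    simp only [mem_prod, mem_univ, true_and, h0]
    rfl
  have hae := hnull.aemeasurable
  refine ⟨hae.mk u', hae.measurable_mk, ?_, ?_⟩
  · filter_upwards [hgood, hae.ae_eq_mk] with ω hω heq
    rw [← heq]
    exact ⟨hω.1.1, hω.2.2⟩
  -- The right-hand side does not involve `j`, which is stationarity.
  · have hlaw : ∀ j R, MeasurableSet R →
        P.map (fun ω => (translate j (fbar ω), translate j (hae.mk u' ω))) R = ν (A R) := by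
      intro j R hR
      have hpair : Measurable fun ω => (translate j (fbar ω), translate j (hae.mk u' ω)) :=
        ((measurable_translate j).comp hfbar).prodMk
          ((measurable_translate j).comp hae.measurable_mk)
      rw [Measure.map_apply hpair hR,
        ← (hmp j).measure_preimage (hA R hR)]
      refine measure_congr ?_
      filter_upwards [hAiff, hae.ae_eq_mk] with ω hω heq
      refine propext (Iff.trans ?_ (hω R j))
      rw [heq]
      rfl
    intro j
    refine Measure.ext fun R hR => (Eq.trans ?_ (hlaw 0 R hR)).trans (hlaw j R hR).symm
    congr 2
    funext ω
    refine Prod.ext ?_ ?_ <;> (funext i; simp [translate, fbar])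

end Measurability

/-! ### A priori bound on the heights -/

section UpperBound

/-- Comparison with the barrier `(F + 3 ε) t + ε i ^ 2` on a finite box. -/
theorem IsSolution.le_of_boundary_le {F : ℝ} {h : ℤ → ℝ → ℝ} {v : ℤ → ℝ → ℝ}
    (hv : IsSolution F h v) (hF : 0 ≤ F) (hh : ∀ i y, 0 ≤ h i y) {ε T : ℝ} (hε : 0 < ε)
    (hT : 0 ≤ T) {N : ℤ} (hN : 0 ≤ N) (hr : v N T ≤ ε * (N : ℝ) ^ 2)
    (hl : v (-N) T ≤ ε * (N : ℝ) ^ 2) : v 0 T ≤ (F + 3 * ε) * T := by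
  by_contra! hcon
  -- The excess over the barrier. A positive maximum over the box and `[0, T]` is interior in space
  -- by `hr`, `hl` and monotonicity in time, and occurs at a positive time.
  let z : ℤ → ℝ → ℝ := fun i s => v i s - ((F + 3 * ε) * s + ε * (i : ℝ) ^ 2)
  have hzc : ∀ i, ContinuousOn (z i) (Icc 0 T) := fun i =>
    ((hv.continuousOn i).mono Icc_subset_Ici_self).sub (by fun_prop)
  choose τ hτmem hτmax using fun i =>
    isCompact_Icc.exists_isMaxOn (nonempty_Icc.2 hT) (hzc i)
  obtain ⟨k, hkmem, hkmax⟩ := Finset.exists_max_image (Finset.Icc (-N) N) (fun i => z i (τ i))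
    ⟨0, by simp [hN]⟩
  have hmax : ∀ i ∈ Finset.Icc (-N) N, ∀ s ∈ Icc 0 T, z i s ≤ z k (τ k) := fun i hi s hs =>
    (hτmax i hs).trans (hkmax i hi)
  obtain ⟨σ, hσ⟩ : ∃ σ, σ = τ k := ⟨_, rfl⟩
  rw [← hσ] at hmax
  have hσmem : σ ∈ Icc 0 T := hσ ▸ hτmem k
  have hpos : 0 < z k σ := by
    have h0 := hmax 0 (by simp [hN]) T ⟨hT, le_rfl⟩
    have : 0 < z 0 T := by
      simp only [z]
      push_cast
      linarith
    linarith
  have hσ0 : 0 < σ := by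
    refine lt_of_le_of_ne hσmem.1 fun h0 => ?_
    rw [← h0] at hpos
    simp only [z, hv.initial] at hpos
    nlinarith [sq_nonneg (k : ℝ)]
  have hbd : ∀ i : ℤ, v i T ≤ ε * (i : ℝ) ^ 2 → k ≠ i := by
    rintro i hi rfl
    have := hv.monotoneOn k hσmem.1 hT hσmem.2
    simp only [z] at hpos
    nlinarith
  have hkN : k ≠ N := hbd N hr
  have hkN' : k ≠ -N := hbd (-N) (by push_cast; rwa [neg_sq])
  rw [Finset.mem_Icc] at hkmem
  have h1 := hmax (k - 1) (by rw [Finset.mem_Icc]; omega) σ hσmem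
  have h2 := hmax (k + 1) (by rw [Finset.mem_Icc]; omega) σ hσmem
  -- At the spatial maximum the discrete Laplacian is at most that of `ε i ^ 2`, namely `2 ε`. The
  -- constant `5 / 2` lies strictly between this and the `3` in the barrier's speed: just before `σ`
  -- the height grows more slowly than the barrier, so the excess was larger at `ρ`.
  have hlap : v (k - 1) σ + v (k + 1) σ - 2 * v k σ < 5 / 2 * ε := by
    simp only [z] at h1 h2
    push_cast at h1 h2
    nlinarith
  have hcont : ContinuousWithinAt (fun s => v (k - 1) s + v (k + 1) s - 2 * v k s) (Ici 0) σ :=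
    (((hv.continuousOn (k - 1)).add (hv.continuousOn (k + 1))).sub
      (continuousOn_const.mul (hv.continuousOn k))) σ hσmem.1
  have hev := hcont.eventually (Iio_mem_nhds hlap)
  have hnhds : 𝓝[Ici 0] σ = 𝓝 σ := nhdsWithin_eq_nhds.2 (Ici_mem_nhds hσ0)
  rw [hnhds] at hev
  obtain ⟨a, ha, hIoc⟩ := exists_Ioc_subset_of_mem_nhds hev ⟨0, hσ0⟩
  let ρ := (max a 0 + σ) / 2
  have haσ : max a 0 < σ := max_lt ha hσ0
  have hρ1 : max a 0 < ρ := by simp only [ρ]; linarith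
  have hρ2 : ρ < σ := by simp only [ρ]; linarith
  have hρ0 : 0 ≤ ρ := (le_max_right a 0).trans hρ1.le
  have hint : v k σ - v k ρ ≤ (F + 5 / 2 * ε) * (σ - ρ) := by
    rw [hv.sub_eq k hρ0 hσ0.le]
    calc ∫ r in ρ..σ, velocity F h v k r ≤ ∫ _ in ρ..σ, (F + 5 / 2 * ε) := by
          refine intervalIntegral.integral_mono_on hρ2.le
            (hv.intervalIntegrable k hρ0 hσ0.le) (by simp) fun r hr => ?_
          have := hIoc ⟨((le_max_left a 0).trans_lt hρ1).trans_le hr.1, hr.2⟩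
          simp only [mem_ofPred_eq] at this
          refine max_le ?_ (by positivity)
          linarith [hh k (v k r)]
      _ = _ := by rw [intervalIntegral.integral_const, smul_eq_mul, mul_comm]
  have hfin := hmax k (by rw [Finset.mem_Icc]; omega) ρ ⟨hρ0, hρ2.le.trans hσmem.2⟩
  simp only [z] at hfin
  nlinarith [mul_pos hε (sub_pos.2 hρ2)]

variable {Ω E : Type*} [MeasurableSpace Ω] [MeasurableSpace E] {P : Measure Ω}
  {ev : E → ℝ → ℝ} {f : ℤ → Ω → E} {F : ℝ} {U : Ω → Heights}

theorem lintegral_translate_eq (hf : ∀ i, Measurable (f i)) (hU : Measurable U)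
    (hstat : JointlyStationary P f U)
    {Ψ : (ℤ → E) × Heights → ℝ≥0∞} (hΨ : Measurable Ψ) (j : ℤ) :
    ∫⁻ ω, Ψ (translate j fun i => f i ω, translate j (U ω)) ∂P
      = ∫⁻ ω, Ψ (fun i => f i ω, U ω) ∂P := by
  have hfbar : Measurable fun ω i => f i ω := measurable_pi_lambda _ hf
  have hj : Measurable fun ω => (translate j fun i => f i ω, translate j (U ω)) :=
    ((measurable_translate j).comp hfbar).prodMk ((measurable_translate j).comp hU)
  rw [← lintegral_map hΨ hj, ← hstat j, lintegral_map hΨ (hfbar.prodMk hU)]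

theorem measurable_height (hU : Measurable U) (i : ℤ) (t : ℝ) : Measurable fun ω => U ω i t :=
  (measurable_eval_heights i).comp (hU.prodMk measurable_const)

theorem measure_height_gt_eq (hf : ∀ i, Measurable (f i)) (hU : Measurable U)
    (hstat : JointlyStationary P f U)
    (j : ℤ) (t c : ℝ) : P {ω | c < U ω j t} = P {ω | c < U ω 0 t} := by
  have hm : Measurable fun q : (ℤ → E) × Heights => q.2 0 t :=
    (measurable_eval_heights 0).comp (measurable_snd.prodMk measurable_const)
  have hS : MeasurableSet {q : (ℤ → E) × Heights | c < q.2 0 t} :=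
    measurableSet_lt measurable_const hm
  have h := lintegral_translate_eq hf hU hstat (measurable_one.indicator hS) j
  have hset : ∀ i, MeasurableSet {ω | c < U ω i t} := fun i =>
    measurableSet_lt measurable_const (measurable_height hU i t)
  rw [← lintegral_indicator_one (hset j), ← lintegral_indicator_one (hset 0)]
  have hj : ∀ ω, {ω | c < U ω j t}.indicator (1 : Ω → ℝ≥0∞) ω
      = {q : (ℤ → E) × Heights | c < q.2 0 t}.indicator 1
        (translate j fun i => f i ω, translate j (U ω)) := fun ω => by
    simp [indicator, translate]
  have h0 : ∀ ω, {ω | c < U ω 0 t}.indicator (1 : Ω → ℝ≥0∞) ω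
      = {q : (ℤ → E) × Heights | c < q.2 0 t}.indicator 1 (fun i => f i ω, U ω) := fun ω => by
    simp [indicator]
  simpa only [hj, h0] using h

/-- Stationarity excludes the fast growth at infinity that could defeat the comparison principle, so
that all heights are at most `F * t`. -/
theorem ae_height_le [IsProbabilityMeasure P] (hF : 0 ≤ F) (hev : ∀ e y, 0 ≤ ev e y) (hf : ∀ i, Measurable (f i))
    (hU : Measurable U)
    (hsol : ∀ᵐ ω ∂P, IsSolution F (fun i => ev (f i ω)) fun i t => U ω i t)
    (hstat : JointlyStationary P f U)
    {t : ℝ} (ht : 0 ≤ t) : ∀ᵐ ω ∂P, ∀ i, U ω i t ≤ F * t := by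
  have hset : ∀ i c, MeasurableSet {ω | c < U ω i t} := fun i c =>
    measurableSet_lt measurable_const (measurable_height hU i t)
  have htail : ∀ ε : ℝ, 0 < ε →
      Tendsto (fun n : ℕ => P {ω | ε * (n : ℝ) ^ 2 < U ω 0 t}) atTop (𝓝 0) := by
    intro ε hε
    have hanti : Antitone fun n : ℕ => {ω | ε * (n : ℝ) ^ 2 < U ω 0 t} := by
      intro m n hmn ω (hω : ε * (n : ℝ) ^ 2 < U ω 0 t)
      refine lt_of_le_of_lt (b := ε * (n : ℝ) ^ 2) ?_ hω
      gcongr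
    have hlim := tendsto_measure_iInter_atTop (μ := P)
      (fun n : ℕ => (hset 0 (ε * (n : ℝ) ^ 2)).nullMeasurableSet) hanti ⟨0, measure_ne_top _ _⟩
    have hempty : ⋂ n : ℕ, {ω | ε * (n : ℝ) ^ 2 < U ω 0 t} = ∅ := by
      rw [eq_empty_iff_forall_notMem]
      intro ω hω
      rw [mem_iInter] at hω
      obtain ⟨n, hn⟩ := exists_nat_ge (max 1 (U ω 0 t / ε))
      have h1 : (1 : ℝ) ≤ n := (le_max_left _ _).trans hn
      have h2 : U ω 0 t ≤ n * ε := (div_le_iff₀ hε).1 ((le_max_right _ _).trans hn)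
      have h3 : ε * (n : ℝ) ^ 2 < U ω 0 t := hω n
      nlinarith [mul_le_mul_of_nonneg_left h1 (mul_nonneg hε.le (zero_le_one.trans h1))]
    rw [hempty, measure_empty] at hlim
    exact hlim
  have hzero : ∀ ε : ℝ, 0 < ε → P {ω | (F + 3 * ε) * t < U ω 0 t} = 0 := by
    intro ε hε
    -- Exceeding the barrier at the origin forces a height above `ε n ^ 2` at site `n` or `-n`. By
    -- stationarity both probabilities equal one at the origin, which vanishes as `n → ∞`.
    have hle : ∀ n : ℕ, P {ω | (F + 3 * ε) * t < U ω 0 t}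
        ≤ P {ω | ε * (n : ℝ) ^ 2 < U ω 0 t} + P {ω | ε * (n : ℝ) ^ 2 < U ω 0 t} := by
      intro n
      calc P {ω | (F + 3 * ε) * t < U ω 0 t}
          ≤ P ({ω | ε * (n : ℝ) ^ 2 < U ω n t} ∪ {ω | ε * (n : ℝ) ^ 2 < U ω (-n) t}) := by
            refine measure_mono_ae ?_
            filter_upwards [hsol] with ω hω hlt
            by_contra hnot
            have hnot' : U ω n t ≤ ε * (n : ℝ) ^ 2 ∧ U ω (-n) t ≤ ε * (n : ℝ) ^ 2 := by
              constructor <;> by_contra! hc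
              · exact hnot (Or.inl hc)
              · exact hnot (Or.inr hc)
            have := hω.le_of_boundary_le hF (fun i y => hev _ y) hε ht
              (N := (n : ℤ)) (by positivity) (by simpa using hnot'.1) (by simpa using hnot'.2)
            exact absurd hlt (not_lt.2 this)
        _ ≤ _ := measure_union_le _ _
        _ = _ := by rw [measure_height_gt_eq hf hU hstat, measure_height_gt_eq hf hU hstat (-n)]
    have := ge_of_tendsto' ((htail ε hε).add (htail ε hε)) hle
    simpa using this
  rw [ae_all_iff]
  intro i
  have hi : ∀ n : ℕ, ∀ᵐ ω ∂P, U ω i t ≤ (F + 3 * (1 / ((n : ℝ) + 1))) * t := by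
    intro n
    rw [ae_iff]
    simp only [not_le]
    rw [measure_height_gt_eq hf hU hstat]
    exact hzero _ (by positivity)
  filter_upwards [ae_all_iff.2 hi] with ω hω
  have hlim : Tendsto (fun n : ℕ => (F + 3 * (1 / ((n : ℝ) + 1))) * t) atTop
      (𝓝 ((F + 3 * 0) * t)) :=
    ((tendsto_one_div_add_atTop_nhds_zero_nat.const_mul 3).const_add F).mul_const t
  simpa using ge_of_tendsto' hlim hω

end UpperBound

/-! ### Measurable envelopes of the obstacles on unit windows -/

section Window

variable {Ω E : Type*} [MeasurableSpace Ω] [MeasurableSpace E] {P : Measure Ω}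
  [IsProbabilityMeasure P] {ev : E → ℝ → ℝ}

/-- Suprema over sections of a jointly measurable function are measurable up to null sets. -/
theorem aemeasurable_iSup_section (ρ : Measure E) [IsFiniteMeasure ρ] {Y : Type*}
    [MeasurableSpace Y] [StandardBorelSpace Y] {φ : E × Y → ℝ≥0∞} (hφ : Measurable φ) {S : Set Y}
    (hS : MeasurableSet S) : AEMeasurable (fun e => ⨆ y ∈ S, φ (e, y)) ρ := by
  have hnull : NullMeasurable (fun e => ⨆ y ∈ S, φ (e, y)) ρ := by
    have : @Measurable (NullMeasurableSpace E ρ) ℝ≥0∞ _ _ (fun e => ⨆ y ∈ S, φ (e, y)) := by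
      refine measurable_of_Ioi fun c => ?_
      have hset : (fun e => ⨆ y ∈ S, φ (e, y)) ⁻¹' Ioi c
          = Prod.fst '' ((Prod.snd ⁻¹' S) ∩ (φ ⁻¹' Ioi c)) := by
        ext e
        simp [lt_iSup_iff]
      exact hset ▸ nullMeasurableSet_image_fst ρ
        ((measurable_snd hS).inter (hφ measurableSet_Ioi))
    exact fun s hs => this hs
  exact hnull.aemeasurable

/-- A measurable envelope of the random function over unit windows that has the same exponential
moment. -/
theorem exists_window_envelope (hev_meas : Measurable fun q : E × ℝ => ev q.1 q.2)
    (hev_nonneg : ∀ e y, 0 ≤ ev e y) {X : Ω → E} (hX : Measurable X) {lam : ℝ} (hlam : 0 < lam)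
    (hfin : windowMoment P lam (fun ω => ev (X ω)) < ∞) :
    ∃ γ : ℤ → E → ℝ, (∀ k, Measurable (γ k)) ∧
      (∀ᵐ e ∂P.map X, ∀ k : ℤ, ∀ y ∈ Ioc ((k : ℝ) - 1 / 2) ((k : ℝ) + 1 / 2), ev e y ≤ γ k e) ∧
      ∀ k, ∫⁻ e, ENNReal.ofReal (Real.exp (lam * γ k e)) ∂P.map X
        ≤ windowMoment P lam fun ω => ev (X ω) := by
  have : IsProbabilityMeasure (P.map X) := Measure.isProbabilityMeasure_map hX.aemeasurable
  let φ : E × ℝ → ℝ≥0∞ := fun q => ENNReal.ofReal (Real.exp (lam * ev q.1 q.2))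
  have hφ : Measurable φ := (Real.measurable_exp.comp (hev_meas.const_mul lam)).ennreal_ofReal
  let G : ℤ → E → ℝ≥0∞ := fun k e => ⨆ y ∈ Ioc ((k : ℝ) - 1 / 2) ((k : ℝ) + 1 / 2), φ (e, y)
  have hG : ∀ k, AEMeasurable (G k) (P.map X) := fun k =>
    aemeasurable_iSup_section _ hφ measurableSet_Ioc
  have hGint : ∀ k, ∫⁻ e, G k e ∂P.map X ≤ windowMoment P lam fun ω => ev (X ω) := by
    intro k
    rw [lintegral_map' (hG k) hX.aemeasurable]
    refine le_trans ?_ (le_iSup (fun n : ℤ => outerExpectation P fun ω =>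
      ⨆ y ∈ Ioc ((n : ℝ) - 1 / 2) ((n : ℝ) + 1 / 2),
        ENNReal.ofReal (Real.exp (lam * ev (X ω) y))) k)
    exact le_iInf fun Z => le_iInf fun _ => le_iInf fun hZ => lintegral_mono hZ
  have hgood : ∀ k, ∀ᵐ e ∂P.map X, G k e = (hG k).mk (G k) e ∧ G k e ≠ ∞ := by
    intro k
    filter_upwards [(hG k).ae_eq_mk, ae_lt_top' (hG k) ((hGint k).trans_lt hfin).ne] with e h1 h2
    exact ⟨h1, h2.ne⟩
  have hle : ∀ (k : ℤ) (e : E), ∀ y ∈ Ioc ((k : ℝ) - 1 / 2) ((k : ℝ) + 1 / 2), φ (e, y) ≤ G k e :=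
    fun k e y hy => le_iSup₂ (f := fun y _ => φ (e, y)) y hy
  -- Nonnegativity of the obstacle keeps the supremum at least `1`, so where it is finite its
  -- logarithm inverts the exponential.
  have hone : ∀ k e, G k e ≠ ∞ → 1 ≤ (G k e).toReal := by
    intro k e hne
    have h1 : (1 : ℝ≥0∞) ≤ G k e := by
      refine le_trans ?_ (hle k e k (by constructor <;> linarith))
      rw [← ENNReal.ofReal_one]
      exact ENNReal.ofReal_le_ofReal (Real.one_le_exp (mul_nonneg hlam.le (hev_nonneg _ _)))
    simpa using ENNReal.toReal_mono hne h1
  refine ⟨fun k e => Real.log ((hG k).mk (G k) e).toReal / lam, fun k => ?_, ?_, fun k => ?_⟩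
  · exact (Real.measurable_log.comp (hG k).measurable_mk.ennreal_toReal).div_const lam
  · filter_upwards [ae_all_iff.2 hgood] with e he k y hy
    rw [← (he k).1, le_div_iff₀ hlam,
      Real.le_log_iff_exp_le (zero_lt_one.trans_le (hone k e (he k).2)), mul_comm]
    exact (ENNReal.ofReal_le_iff_le_toReal (he k).2).1 (hle k e y hy)
  · refine le_trans (le_of_eq ?_) (hGint k)
    refine lintegral_congr_ae ?_
    filter_upwards [hgood k] with e he
    rw [← he.1, mul_div_cancel₀ _ hlam.ne',
      Real.exp_log (zero_lt_one.trans_le (hone k e he.2)), ENNReal.ofReal_toReal he.2]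

theorem one_le_windowMoment {h : Ω → ℝ → ℝ} (hh : ∀ ω y, 0 ≤ h ω y) {lam : ℝ} (hlam : 0 < lam) :
    1 ≤ windowMoment P lam h := by
  refine le_trans ?_ (le_iSup (fun n : ℤ => outerExpectation P fun ω =>
      ⨆ y ∈ Ioc ((n : ℝ) - 1 / 2) ((n : ℝ) + 1 / 2),
        ENNReal.ofReal (Real.exp (lam * h ω y))) 0)
  refine le_iInf fun Z => le_iInf fun _ => le_iInf fun hZ => ?_
  calc (1 : ℝ≥0∞) = ∫⁻ _, 1 ∂P := by simp
    _ ≤ ∫⁻ ω, Z ω ∂P := by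
      refine lintegral_mono fun ω => le_trans ?_ (hZ ω)
      refine le_trans ?_ (le_iSup₂ (f := fun y _ => ENNReal.ofReal (Real.exp (lam * h ω y))) 0
        (by constructor <;> norm_num))
      rw [← ENNReal.ofReal_one]
      exact ENNReal.ofReal_le_ofReal (Real.one_le_exp (mul_nonneg hlam.le (hh _ _)))

end Window

/-! ### Exponential weights of integer paths -/

section Branching

/-- The weight of a path with second difference `D` at a site where the obstacle has strength `g`. -/
def stepWeight (lam μ F g : ℝ) (D : ℤ) : ℝ≥0∞ :=
  ENNReal.ofReal (Real.exp (lam * D - μ * max (D - g + F - 2) 0))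

theorem p_pos {lam μ : ℝ} (hlam : 0 < lam) (hμ : lam < μ) : 0 < p lam μ := by
  have h1 : Real.exp (-lam) < 1 := Real.exp_lt_one_iff.2 (by linarith)
  have h2 : Real.exp (lam - μ) < 1 := Real.exp_lt_one_iff.2 (by linarith)
  have h3 : 0 < 1 - Real.exp (-lam) := by linarith
  have h4 : 0 < 1 - Real.exp (lam - μ) := by linarith
  unfold p
  positivity

theorem tsum_ofReal_exp_neg_mul {a : ℝ} (ha : 0 < a) :
    ∑' n : ℕ, ENNReal.ofReal (Real.exp (-a * n)) = ENNReal.ofReal (1 / (1 - Real.exp (-a))) := by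
  have hlt : Real.exp (-a) < 1 := Real.exp_lt_one_iff.2 (by linarith)
  have hpow : ∀ n : ℕ, Real.exp (-a * n) = Real.exp (-a) ^ n := fun n => by
    rw [← Real.exp_nat_mul, mul_comm]
  simp only [hpow]
  rw [← ENNReal.ofReal_tsum_of_nonneg (fun n => by positivity)
    (summable_geometric_of_lt_one (Real.exp_pos _).le hlt),
    tsum_geometric_of_lt_one (Real.exp_pos _).le hlt, one_div]

/-- The positive part switches on at `D = s = g - F + 2`. The weight decays geometrically from `exp
(lam * s)` on both sides, at rate `μ - lam` above and `lam` below; the two series add up to `p lam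
μ`. -/
theorem tsum_stepWeight_le {lam μ : ℝ} (hlam : 0 < lam) (hμ : lam < μ) (F g : ℝ) :
    ∑' D : ℤ, stepWeight lam μ F g D
      ≤ ENNReal.ofReal (p lam μ * Real.exp (-(lam * (F - 2)))) *
        ENNReal.ofReal (Real.exp (lam * g)) := by
  obtain ⟨s, hs⟩ : ∃ s, s = g - F + 2 := ⟨_, rfl⟩
  have hceil := Int.ceil_lt_add_one s
  have hceil' := Int.le_ceil s
  have hpos : ∀ n : ℕ, stepWeight lam μ F g (⌈s⌉ + n)
      ≤ ENNReal.ofReal (Real.exp (lam * s)) * ENNReal.ofReal (Real.exp (-(μ - lam) * n)) := by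
    intro n
    rw [stepWeight, ← ENNReal.ofReal_mul (Real.exp_pos _).le, ← Real.exp_add]
    refine ENNReal.ofReal_le_ofReal (Real.exp_le_exp.2 ?_)
    have hn : (0 : ℝ) ≤ n := n.cast_nonneg
    push_cast
    rw [max_eq_left (by linarith)]
    nlinarith
  have hneg : ∀ n : ℕ, stepWeight lam μ F g (⌈s⌉ + (-((n : ℤ) + 1)))
      ≤ ENNReal.ofReal (Real.exp (lam * s)) * ENNReal.ofReal (Real.exp (-lam * n)) := by
    intro n
    rw [stepWeight, ← ENNReal.ofReal_mul (Real.exp_pos _).le, ← Real.exp_add]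
    refine ENNReal.ofReal_le_ofReal (Real.exp_le_exp.2 ?_)
    have hn : (0 : ℝ) ≤ n := n.cast_nonneg
    push_cast
    rw [max_eq_right (by linarith)]
    nlinarith
  have hp : p lam μ = 1 / (1 - Real.exp (-lam)) + 1 / (1 - Real.exp (-(μ - lam))) := by
    rw [p, neg_sub]
  have h1 : 0 ≤ 1 / (1 - Real.exp (-lam)) :=
    one_div_nonneg.2 (sub_nonneg.2 (Real.exp_le_one_iff.2 (by linarith)))
  have h2 : 0 ≤ 1 / (1 - Real.exp (-(μ - lam))) :=
    one_div_nonneg.2 (sub_nonneg.2 (Real.exp_le_one_iff.2 (by linarith)))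
  calc ∑' D : ℤ, stepWeight lam μ F g D
      = ∑' D : ℤ, stepWeight lam μ F g (⌈s⌉ + D) := ((Equiv.addLeft ⌈s⌉).tsum_eq _).symm
    _ = ∑' n : ℕ, stepWeight lam μ F g (⌈s⌉ + n)
        + ∑' n : ℕ, stepWeight lam μ F g (⌈s⌉ + (-((n : ℤ) + 1))) :=
      tsum_of_nat_of_neg_add_one (f := fun D : ℤ => stepWeight lam μ F g (⌈s⌉ + D))
        ENNReal.summable ENNReal.summable
    _ ≤ ∑' n : ℕ, ENNReal.ofReal (Real.exp (lam * s)) *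
          ENNReal.ofReal (Real.exp (-(μ - lam) * n))
        + ∑' n : ℕ, ENNReal.ofReal (Real.exp (lam * s)) * ENNReal.ofReal (Real.exp (-lam * n)) :=
      add_le_add (ENNReal.tsum_le_tsum hpos) (ENNReal.tsum_le_tsum hneg)
    _ = ENNReal.ofReal (Real.exp (lam * s)) * ENNReal.ofReal (p lam μ) := by
      rw [ENNReal.tsum_mul_left, ENNReal.tsum_mul_left, ← mul_add,
        tsum_ofReal_exp_neg_mul hlam, tsum_ofReal_exp_neg_mul (sub_pos.2 hμ),
        ← ENNReal.ofReal_add h2 h1, hp, add_comm]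
    _ = _ := by
      rw [← ENNReal.ofReal_mul (Real.exp_pos _).le,
        ← ENNReal.ofReal_mul (mul_nonneg (p_pos hlam hμ).le (Real.exp_pos _).le), mul_assoc,
        ← Real.exp_add, mul_comm, hs]
      congr 3
      ring

variable {E : Type*}

/-- The total weight of all integer paths that start with the heights `a`, `b` at the sites `m - 1`,
`m` and make `n` further steps, in the environment `e`. -/
def branchSum (w : ℤ → E → ℤ → ℝ≥0∞) (e : ℕ → E) : ℕ → ℕ → ℤ → ℤ → ℝ≥0∞
  | _, 0, _, _ => 1
  | m, n + 1, a, b => ∑' D : ℤ, w b (e m) D * branchSum w e (m + 1) n b (2 * b - a + D)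

/-- The path `κ` is one of those summed: at each step keep only the term in which `D` is its own
second difference. -/
theorem prod_weight_le_branchSum (w : ℤ → E → ℤ → ℝ≥0∞) (e : ℕ → E) (κ : ℕ → ℤ) (n m : ℕ) :
    ∏ j ∈ Finset.range n, w (κ (m + j + 1)) (e (m + j))
      (κ (m + j + 2) + κ (m + j) - 2 * κ (m + j + 1))
      ≤ branchSum w e m n (κ m) (κ (m + 1)) := by
  induction n generalizing m with
  | zero => simp [branchSum]
  | succ n ih =>
    rw [Finset.prod_range_succ', mul_comm, branchSum]
    refine le_trans ?_ (ENNReal.le_tsum (κ (m + 2) + κ m - 2 * κ (m + 1)))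
    refine mul_le_mul' (by simp) ?_
    rw [show 2 * κ (m + 1) - κ m + (κ (m + 2) + κ m - 2 * κ (m + 1)) = κ (m + 1 + 1) by
      rw [show m + 1 + 1 = m + 2 by ring]; ring]
    refine le_trans (le_of_eq (Finset.prod_congr rfl fun j _ => ?_)) (ih (m + 1))
    rw [show m + (j + 1) = m + 1 + j by ring]

variable {Ω : Type*} [MeasurableSpace Ω] [MeasurableSpace E] {P : Measure Ω}

theorem measurable_branchSum {w : ℤ → E → ℤ → ℝ≥0∞} (hw : ∀ k D, Measurable fun e => w k e D)
    (n m : ℕ) (a b : ℤ) : Measurable fun e : ℕ → E => branchSum w e m n a b := by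
  induction n generalizing m a b with
  | zero => simpa only [branchSum] using measurable_const
  | succ n ih =>
    simp only [branchSum]
    exact Measurable.tsum fun D =>
      ((hw b D).comp (measurable_pi_apply m)).mul (ih (m + 1) b _)

/-- Once `D` is fixed, the weight at site `m` depends only on `X m` and joins the product of
independent factors. Carrying this product `φ` through the induction avoids conditioning; the sum
over `D` is bounded by `c` only after the remaining sites are integrated. -/
theorem lintegral_prod_mul_branchSum_le [IsProbabilityMeasure P] {X : ℕ → Ω → E}
    (hX : ∀ m, Measurable (X m)) (hind : iIndepFun X P) {w : ℤ → E → ℤ → ℝ≥0∞}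
    (hw : ∀ k D, Measurable fun e => w k e D) {c : ℝ≥0∞}
    (hc : ∀ m k, ∑' D : ℤ, ∫⁻ ω, w k (X m ω) D ∂P ≤ c) (n m : ℕ) (a b : ℤ)
    (φ : ℕ → E → ℝ≥0∞) (hφ : ∀ j, Measurable (φ j)) :
    ∫⁻ ω, (∏ j ∈ Finset.range m, φ j (X j ω)) * branchSum w (fun j => X j ω) m n a b ∂P
      ≤ (∏ j ∈ Finset.range m, ∫⁻ ω, φ j (X j ω) ∂P) * c ^ n := by
  classical
  induction n generalizing m a b φ with
  | zero =>
    simp only [branchSum, mul_one, pow_zero]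
    exact (lintegral_prod_eq_prod_lintegral_of_indepFun (Finset.range m)
      (fun j ω => φ j (X j ω)) (hind.comp _ hφ) fun j => (hφ j).comp (hX j)).le
  | succ n ih =>
    have hXm : Measurable fun ω j => X j ω := measurable_pi_lambda _ hX
    let ψ : ℤ → ℕ → E → ℝ≥0∞ := fun D => Function.update φ m fun e => w b e D
    have hψ : ∀ D j, Measurable (ψ D j) := by
      intro D j
      by_cases h : j = m
      · subst h
        simpa [ψ] using hw b D
      · simpa [ψ, h] using hφ j
    have hψlt : ∀ D, ∀ j ∈ Finset.range m, ψ D j = φ j := fun D j hj => by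
      simp [ψ, (Finset.mem_range.1 hj).ne]
    have hψm : ∀ D, ψ D m = fun e => w b e D := fun D => by simp [ψ]
    calc ∫⁻ ω, (∏ j ∈ Finset.range m, φ j (X j ω)) *
          branchSum w (fun j => X j ω) m (n + 1) a b ∂P
        = ∫⁻ ω, ∑' D : ℤ, (∏ j ∈ Finset.range (m + 1), ψ D j (X j ω)) *
            branchSum w (fun j => X j ω) (m + 1) n b (2 * b - a + D) ∂P := by
          refine lintegral_congr fun ω => ?_
          rw [branchSum, ← ENNReal.tsum_mul_left]
          refine tsum_congr fun D => ?_
          rw [Finset.prod_range_succ, hψm,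
            Finset.prod_congr rfl fun j hj => congrFun (hψlt D j hj) (X j ω), mul_assoc]
      _ = ∑' D : ℤ, ∫⁻ ω, (∏ j ∈ Finset.range (m + 1), ψ D j (X j ω)) *
            branchSum w (fun j => X j ω) (m + 1) n b (2 * b - a + D) ∂P := by
          refine lintegral_tsum fun D => (Measurable.mul ?_ ?_).aemeasurable
          · exact Finset.measurable_prod _ fun j _ => (hψ D j).comp (hX j)
          · exact (measurable_branchSum hw n (m + 1) b _).comp hXm
      _ ≤ ∑' D : ℤ, (∏ j ∈ Finset.range (m + 1), ∫⁻ ω, ψ D j (X j ω) ∂P) * c ^ n :=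
          ENNReal.tsum_le_tsum fun D => ih (m + 1) b _ (ψ D) (hψ D)
      _ = (∏ j ∈ Finset.range m, ∫⁻ ω, φ j (X j ω) ∂P) *
            (∑' D : ℤ, ∫⁻ ω, w b (X m ω) D ∂P) * c ^ n := by
          rw [ENNReal.tsum_mul_right, ← ENNReal.tsum_mul_left]
          congr 1
          refine tsum_congr fun D => ?_
          rw [Finset.prod_range_succ, hψm]
          congr 1
          exact Finset.prod_congr rfl fun j hj => by rw [hψlt D j hj]
      _ ≤ (∏ j ∈ Finset.range m, ∫⁻ ω, φ j (X j ω) ∂P) * c * c ^ n := by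
          gcongr
          exact hc m b
      _ = _ := by rw [mul_assoc, ← pow_succ']

end Branching

/-! ### Lower bound for the mean velocity -/

section VelocityBound

/-- This is the origin of the `2` in `F - 2`: rounding raises each neighbour by less than `1 / 2`
and lowers the centre by at most `1 / 2`, counted twice. -/
theorem ceil_second_difference_le (a b c : ℝ) :
    ((⌈c - 1 / 2⌉ + ⌈a - 1 / 2⌉ - 2 * ⌈b - 1 / 2⌉ : ℤ) : ℝ) - 2 ≤ a + c - 2 * b := by
  have ha := Int.ceil_lt_add_one (a - 1 / 2)
  have hc := Int.ceil_lt_add_one (c - 1 / 2)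
  have hb := Int.le_ceil (b - 1 / 2)
  push_cast
  linarith

theorem mem_window_ceil (y : ℝ) :
    y ∈ Ioc ((⌈y - 1 / 2⌉ : ℝ) - 1 / 2) ((⌈y - 1 / 2⌉ : ℝ) + 1 / 2) := by
  have h1 := Int.ceil_lt_add_one (y - 1 / 2)
  have h2 := Int.le_ceil (y - 1 / 2)
  constructor <;> linarith

theorem sum_second_difference (κ : ℕ → ℤ) (n : ℕ) :
    ∑ j ∈ Finset.range n, (κ (j + 2) + κ j - 2 * κ (j + 1)) = κ (n + 1) - κ n - (κ 1 - κ 0) := by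
  induction n with
  | zero => simp
  | succ n ih =>
    rw [Finset.sum_range_succ, ih]
    ring

/-- The rounded heights form one of the paths counted by `branchSum`, and its weight is controlled
by the velocities. -/
theorem exp_le_branchSum {E : Type*} {ev : E → ℝ → ℝ} {lam μ F t : ℝ} (hlam : 0 < lam)
    (hμ : lam < μ) {e : ℤ → E} {v : ℤ → ℝ → ℝ} {γ : ℤ → E → ℝ} {M : ℤ}
    (hγ : ∀ i : ℕ, ∀ k : ℤ, ∀ y ∈ Ioc ((k : ℝ) - 1 / 2) ((k : ℝ) + 1 / 2),
      ev (e i) y ≤ γ k (e i))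
    (hv0 : ∀ i, 0 ≤ v i t) (hvM : ∀ i, v i t ≤ M) (n : ℕ) :
    ENNReal.ofReal (Real.exp (-(2 * lam * M) -
        μ * ∑ j ∈ Finset.range n, velocity F (fun i => ev (e i)) v j t))
      ≤ ∑ a ∈ Finset.Icc 0 M, ∑ b ∈ Finset.Icc 0 M,
        branchSum (fun k e => stepWeight lam μ F (γ k e)) (fun i => e i) 0 n a b := by
  -- The index is shifted by one: `κ 0` and `κ 1` are the rounded heights at sites `-1` and `0`, as
  -- `branchSum` expects at `m = 0`.
  let κ : ℕ → ℤ := fun j => ⌈v ((j : ℤ) - 1) t - 1 / 2⌉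
  have hκ0 : ∀ j, 0 ≤ κ j := fun j => by
    have := hv0 ((j : ℤ) - 1)
    exact Int.le_ceil_iff.2 (by push_cast; linarith)
  have hκM : ∀ j, κ j ≤ M := fun j => by
    have := hvM ((j : ℤ) - 1)
    exact Int.ceil_le.2 (by linarith)
  have hκmem : ∀ j, κ j ∈ Finset.Icc 0 M := fun j => Finset.mem_Icc.2 ⟨hκ0 j, hκM j⟩
  have hbranch := prod_weight_le_branchSum (fun k e => stepWeight lam μ F (γ k e))
    (fun i : ℕ => e i) κ n 0
  simp only [zero_add] at hbranch
  refine le_trans ?_ (hbranch.trans ?_)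
  · calc ENNReal.ofReal (Real.exp (-(2 * lam * M) -
        μ * ∑ j ∈ Finset.range n, velocity F (fun i => ev (e i)) v j t))
        ≤ ENNReal.ofReal (Real.exp (∑ j ∈ Finset.range n,
          (lam * (κ (j + 2) + κ j - 2 * κ (j + 1) : ℤ)
            - μ * velocity F (fun i => ev (e i)) v j t))) := by
          refine ENNReal.ofReal_le_ofReal (Real.exp_le_exp.2 ?_)
          rw [Finset.sum_sub_distrib, ← Finset.mul_sum, ← Finset.mul_sum, ← Int.cast_sum,
            sum_second_difference]
          have h1 : -(2 * M : ℤ) ≤ κ (n + 1) - κ n - (κ 1 - κ 0) := by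
            linarith [hκ0 (n + 1), hκM n, hκM 1, hκ0 0]
          have h2 : -(2 * (M : ℝ)) ≤ ((κ (n + 1) - κ n - (κ 1 - κ 0) : ℤ) : ℝ) := by
            exact_mod_cast h1
          nlinarith
      _ = ∏ j ∈ Finset.range n, ENNReal.ofReal (Real.exp
          (lam * (κ (j + 2) + κ j - 2 * κ (j + 1) : ℤ)
            - μ * velocity F (fun i => ev (e i)) v j t)) := by
          rw [Real.exp_sum, ENNReal.ofReal_prod_of_nonneg fun j _ => (Real.exp_pos _).le]
      _ ≤ _ := by
          refine Finset.prod_le_prod' fun j _ => ?_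
          refine ENNReal.ofReal_le_ofReal (Real.exp_le_exp.2 ?_)
          have hround := ceil_second_difference_le (v ((j : ℤ) - 1) t) (v j t) (v ((j : ℤ) + 1) t)
          have hobst := hγ j _ _ (mem_window_ceil (v j t))
          have hκj : κ (j + 1) = ⌈v j t - 1 / 2⌉ := by
            simp [κ]
          have hκj2 : κ (j + 2) = ⌈v ((j : ℤ) + 1) t - 1 / 2⌉ := by
            simp only [κ]
            push_cast
            rw [show (j : ℤ) + 2 - 1 = j + 1 by ring]
          have hmax : max (((κ (j + 2) + κ j - 2 * κ (j + 1) : ℤ) : ℝ)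
              - γ (κ (j + 1)) (e j) + F - 2) 0 ≤ velocity F (fun i => ev (e i)) v j t := by
            refine max_le_max ?_ le_rfl
            rw [hκj, hκj2]
            linarith
          have := mul_le_mul_of_nonneg_left hmax (hlam.le.trans hμ.le)
          linarith
  · calc branchSum (fun k e => stepWeight lam μ F (γ k e)) (fun i : ℕ => e i) 0 n (κ 0) (κ 1)
        ≤ ∑ b ∈ Finset.Icc 0 M,
          branchSum (fun k e => stepWeight lam μ F (γ k e)) (fun i : ℕ => e i) 0 n (κ 0) b :=
          Finset.single_le_sum_of_canonicallyOrdered (f := fun b =>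
            branchSum (fun k e => stepWeight lam μ F (γ k e)) (fun i : ℕ => e i) 0 n (κ 0) b)
            (hκmem 1)
      _ ≤ _ := Finset.single_le_sum_of_canonicallyOrdered (f := fun a => ∑ b ∈ Finset.Icc 0 M,
            branchSum (fun k e => stepWeight lam μ F (γ k e)) (fun i : ℕ => e i) 0 n a b)
            (hκmem 0)

theorem nonpos_of_forall_nat_mul_le {x K : ℝ} (h : ∀ n : ℕ, n * x ≤ K) : x ≤ 0 := by
  by_contra! hx
  obtain ⟨n, hn⟩ := exists_nat_gt (K / x)
  rw [div_lt_iff₀ hx] at hn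
  exact absurd (h n) (not_le.2 hn)

variable {Ω E : Type*} [MeasurableSpace Ω] [MeasurableSpace E] {P : Measure Ω}
  {ev : E → ℝ → ℝ} {f : ℤ → Ω → E} {F : ℝ} {U : Ω → Heights}

theorem measurable_velocity_comp (hev : Measurable fun q : E × ℝ => ev q.1 q.2)
    (hf : ∀ i, Measurable (f i)) (hU : Measurable U) (i : ℤ) :
    Measurable fun q : Ω × ℝ =>
      velocity F (fun i => ev (f i q.1)) (fun i s => U q.1 i s) i q.2 :=
  (measurable_velocity hev F i).comp
    (((measurable_pi_lambda _ fun i => (hf i).comp measurable_fst).prodMk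
      (hU.comp measurable_fst)).prodMk measurable_snd)

theorem velocity_le_of_height_le {h v : ℤ → ℝ → ℝ} {t B : ℝ} (hF : 0 ≤ F)
    (hh : ∀ i y, 0 ≤ h i y) (hv0 : ∀ i, 0 ≤ v i t) (hvB : ∀ i, v i t ≤ B) (i : ℤ) :
    velocity F h v i t ≤ 2 * B + F := by
  have hB : 0 ≤ B := (hv0 0).trans (hvB 0)
  refine max_le ?_ (by positivity)
  linarith [hh i (v i t), hv0 i, hvB (i - 1), hvB (i + 1)]

theorem integral_velocity_eq (hev : Measurable fun q : E × ℝ => ev q.1 q.2)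
    (hf : ∀ i, Measurable (f i)) (hU : Measurable U) (hstat : JointlyStationary P f U)
    (j : ℤ) (t : ℝ) :
    ∫ ω, velocity F (fun i => ev (f i ω)) (fun i s => U ω i s) j t ∂P
      = ∫ ω, velocity F (fun i => ev (f i ω)) (fun i s => U ω i s) 0 t ∂P := by
  have hm : ∀ i, Measurable fun ω => velocity F (fun i => ev (f i ω)) (fun i s => U ω i s) i t :=
    fun i => (measurable_velocity_comp hev hf hU i).comp measurable_prodMk_right
  rw [integral_eq_lintegral_of_nonneg_ae (ae_of_all _ fun ω => velocity_nonneg _ _)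
      (hm j).aestronglyMeasurable,
    integral_eq_lintegral_of_nonneg_ae (ae_of_all _ fun ω => velocity_nonneg _ _)
      (hm 0).aestronglyMeasurable]
  have hΨ : Measurable fun q : (ℤ → E) × Heights =>
      ENNReal.ofReal (velocity F (fun i => ev (q.1 i)) (fun i s => q.2 i s) 0 t) :=
    ((measurable_velocity hev F 0).comp measurable_prodMk_right).ennreal_ofReal
  rw [← lintegral_translate_eq hf hU hstat hΨ j]
  congr 1
  refine lintegral_congr fun ω => ?_
  have := velocity_translate (F := F) (h := fun i => ev (f i ω)) (v := fun i s => U ω i s) j 0 t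
  rw [zero_add] at this
  rw [← this]
  rfl

theorem ae_velocity_le [IsProbabilityMeasure P] (hF : 0 ≤ F) (hev : ∀ e y, 0 ≤ ev e y) (hf : ∀ i, Measurable (f i))
    (hU : Measurable U)
    (hsol : ∀ᵐ ω ∂P, IsSolution F (fun i => ev (f i ω)) fun i t => U ω i t)
    (hstat : JointlyStationary P f U) {T : ℝ} (hT : 0 ≤ T) :
    ∀ᵐ ω ∂P, ∀ i, ∀ t ∈ Icc 0 T,
      velocity F (fun i => ev (f i ω)) (fun i s => U ω i s) i t ≤ 2 * (F * T) + F := by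
  filter_upwards [hsol, ae_height_le hF hev hf hU hsol hstat hT] with ω hω hb i t ht
  refine velocity_le_of_height_le hF (fun i y => hev _ _) (fun i => hω.nonneg i ht.1)
    (fun i => ?_) i
  exact (hω.monotoneOn i ht.1 hT ht.2).trans (hb i)

theorem integrable_velocity [IsProbabilityMeasure P] (hF : 0 ≤ F) (hev_meas : Measurable fun q : E × ℝ => ev q.1 q.2)
    (hev : ∀ e y, 0 ≤ ev e y) (hf : ∀ i, Measurable (f i)) (hU : Measurable U)
    (hsol : ∀ᵐ ω ∂P, IsSolution F (fun i => ev (f i ω)) fun i t => U ω i t)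
    (hstat : JointlyStationary P f U) {t : ℝ} (ht : 0 ≤ t) (i : ℤ) :
    Integrable (fun ω => velocity F (fun i => ev (f i ω)) (fun i s => U ω i s) i t) P := by
  refine Integrable.of_bound (C := 2 * (F * t) + F)
    ((measurable_velocity_comp hev_meas hf hU i).comp
      measurable_prodMk_right).aestronglyMeasurable ?_
  filter_upwards [ae_velocity_le hF hev hf hU hsol hstat ht] with ω hω
  rw [Real.norm_of_nonneg (velocity_nonneg _ _)]
  exact hω i t ⟨ht, le_rfl⟩

/-- A first-moment bound over paths of length `n`, followed by Jensen's inequality. The number of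
starting pairs and the boundary term `2 lam M` do not depend on `n` and disappear after division by
`n`. -/
theorem exponent_le_integral_velocity [IsProbabilityMeasure P] (hF : 0 ≤ F)
    (hev_meas : Measurable fun q : E × ℝ => ev q.1 q.2)
    (hev : ∀ e y, 0 ≤ ev e y) (hf : ∀ i, Measurable (f i))
    (hf_indep : iIndepFun f P) (hf_ident : ∀ i, IdentDistrib (f i) (f 0) P P)
    (hU : Measurable U)
    (hsol : ∀ᵐ ω ∂P, IsSolution F (fun i => ev (f i ω)) fun i t => U ω i t)
    (hstat : JointlyStationary P f U) {lam μ : ℝ} (hlam : 0 < lam) (hμ : lam < μ)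
    (hfin : windowMoment P lam (fun ω => ev (f 0 ω)) < ∞) {t : ℝ} (ht : 0 ≤ t) :
    1 / μ * (lam * (F - 2) - Real.log (p lam μ)
      - Real.log (windowMoment P lam fun ω => ev (f 0 ω)).toReal)
      ≤ ∫ ω, velocity F (fun i => ev (f i ω)) (fun i s => U ω i s) 0 t ∂P := by
  obtain ⟨β, hβ⟩ : ∃ β, β = windowMoment P lam fun ω => ev (f 0 ω) := ⟨_, rfl⟩
  obtain ⟨γ, hγ_meas, hγ_le, hγ_int⟩ := exists_window_envelope hev_meas hev (hf 0) hlam hfin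
  rw [← hβ] at hfin hγ_int ⊢
  have hμ0 : 0 < μ := hlam.trans hμ
  have hβ1 : 1 ≤ β := hβ ▸ one_le_windowMoment (fun ω y => hev _ y) hlam
  have hβpos : 0 < β.toReal := ENNReal.toReal_pos (zero_lt_one.trans_le hβ1).ne' hfin.ne
  let α := ∫ ω, velocity F (fun i => ev (f i ω)) (fun i s => U ω i s) 0 t ∂P
  let V : ℤ → Ω → ℝ := fun i ω => velocity F (fun i => ev (f i ω)) (fun i s => U ω i s) i t
  have hV_int : ∀ i, Integrable (V i) P := fun i =>
    integrable_velocity hF hev_meas hev hf hU hsol hstat ht i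
  have hV_eq : ∀ i, ∫ ω, V i ω ∂P = α := fun i => integral_velocity_eq hev_meas hf hU hstat i t
  let M : ℤ := ⌈F * t⌉
  let w : ℤ → E → ℤ → ℝ≥0∞ := fun k e => stepWeight lam μ F (γ k e)
  have hw : ∀ k D, Measurable fun e => w k e D := by
    intro k D
    have := hγ_meas k
    simp only [w, stepWeight]
    fun_prop
  let c : ℝ := p lam μ * Real.exp (-(lam * (F - 2))) * β.toReal
  have hp := p_pos hlam hμ
  have hc0 : 0 < c := by positivity
  have hc : ∀ (m : ℕ) (k : ℤ), ∑' D : ℤ, ∫⁻ ω, w k (f m ω) D ∂P ≤ ENNReal.ofReal c := by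
    intro m k
    have hwm : ∀ D, AEMeasurable (fun ω => w k (f m ω) D) P := fun D =>
      ((hw k D).comp (hf m)).aemeasurable
    rw [← lintegral_tsum hwm]
    have hm : Measurable fun e => ENNReal.ofReal (Real.exp (lam * γ k e)) := by
      have := hγ_meas k
      fun_prop
    calc ∫⁻ ω, ∑' D : ℤ, w k (f m ω) D ∂P
        ≤ ∫⁻ ω, ENNReal.ofReal (p lam μ * Real.exp (-(lam * (F - 2)))) *
          ENNReal.ofReal (Real.exp (lam * γ k (f m ω))) ∂P :=
          lintegral_mono fun ω => tsum_stepWeight_le hlam hμ F _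
      _ = ENNReal.ofReal (p lam μ * Real.exp (-(lam * (F - 2)))) *
          ∫⁻ e, ENNReal.ofReal (Real.exp (lam * γ k e)) ∂P.map (f 0) := by
          rw [← (hf_ident m).map_eq, lintegral_map hm (hf m)]
          exact lintegral_const_mul _ (hm.comp (hf m))
      _ ≤ ENNReal.ofReal (p lam μ * Real.exp (-(lam * (F - 2)))) * β := by
          gcongr
          exact hγ_int k
      _ = ENNReal.ofReal c := by
          simp only [c]
          rw [ENNReal.ofReal_mul (p := p lam μ * _) (by positivity),
            ENNReal.ofReal_toReal hfin.ne]
  have hγ_all : ∀ᵐ ω ∂P, ∀ i : ℕ, ∀ k : ℤ, ∀ y ∈ Ioc ((k : ℝ) - 1 / 2) ((k : ℝ) + 1 / 2),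
      ev (f i ω) y ≤ γ k (f i ω) := by
    rw [ae_all_iff]
    intro i
    rw [← (hf_ident i).map_eq] at hγ_le
    exact ae_of_ae_map (hf i).aemeasurable hγ_le
  let C : ℝ := ((Finset.Icc 0 M).card : ℝ) * (Finset.Icc 0 M).card
  have hM : 0 ≤ M := Int.ceil_nonneg (mul_nonneg hF ht)
  have hC : 0 < C := by
    have : 0 < (Finset.Icc 0 M).card := Finset.card_pos.2 ⟨0, Finset.mem_Icc.2 ⟨le_rfl, hM⟩⟩
    positivity
  let Y : ℕ → Ω → ℝ := fun n ω => -(2 * lam * M) - μ * ∑ j ∈ Finset.range n, V j ω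
  have hV_int' : ∀ n : ℕ, ∀ j ∈ Finset.range n, Integrable (fun ω => V (j : ℤ) ω) P :=
    fun _ j _ => hV_int j
  have hS_int : ∀ n : ℕ, Integrable (fun ω => μ * ∑ j ∈ Finset.range n, V (j : ℤ) ω) P := fun n =>
    (integrable_finsetSum _ (hV_int' n)).const_mul μ
  have hY_int : ∀ n, Integrable (Y n) P := fun n => (integrable_const _).sub (hS_int n)
  have hY_eq : ∀ n, ∫ ω, Y n ω ∂P = -(2 * lam * M) - μ * (n * α) := by
    intro n
    simp only [Y]
    rw [integral_sub (integrable_const _) (hS_int n), integral_const_mul,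
      integral_finsetSum _ (hV_int' n)]
    simp [hV_eq]
  have hlint : ∀ n, ∫⁻ ω, ENNReal.ofReal (Real.exp (Y n ω)) ∂P ≤ ENNReal.ofReal (C * c ^ n) := by
    intro n
    have hbm : ∀ a b, Measurable fun ω => branchSum w (fun i : ℕ => f i ω) 0 n a b := fun a b =>
      (measurable_branchSum hw n 0 a b).comp (measurable_pi_lambda _ fun i : ℕ => hf i)
    have hb : ∀ a b, ∫⁻ ω, branchSum w (fun i : ℕ => f i ω) 0 n a b ∂P
        ≤ ENNReal.ofReal c ^ n := by
      intro a b
      have := lintegral_prod_mul_branchSum_le (X := fun m : ℕ => f m) (fun m => hf m)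
        (hf_indep.precomp Nat.cast_injective) hw hc n 0 a b (fun _ _ => 1)
        fun _ => measurable_const
      simpa using this
    calc ∫⁻ ω, ENNReal.ofReal (Real.exp (Y n ω)) ∂P
        ≤ ∫⁻ ω, ∑ a ∈ Finset.Icc 0 M, ∑ b ∈ Finset.Icc 0 M,
          branchSum w (fun i : ℕ => f i ω) 0 n a b ∂P := by
          refine lintegral_mono_ae ?_
          filter_upwards [hsol, hγ_all, ae_height_le hF hev hf hU hsol hstat ht] with ω h1 h2 h3
          exact exp_le_branchSum (e := fun i => f i ω) (v := fun i s => U ω i s) hlam hμ h2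
            (fun i => h1.nonneg i ht) (fun i => (h3 i).trans (Int.le_ceil _)) n
      _ = ∑ a ∈ Finset.Icc 0 M, ∑ b ∈ Finset.Icc 0 M,
          ∫⁻ ω, branchSum w (fun i : ℕ => f i ω) 0 n a b ∂P := by
          rw [lintegral_finsetSum _ fun a _ => Finset.measurable_sum _ fun b _ => hbm a b]
          refine Finset.sum_congr rfl fun a _ => ?_
          rw [lintegral_finsetSum _ fun b _ => hbm a b]
      _ ≤ ∑ a ∈ Finset.Icc 0 M, ∑ b ∈ Finset.Icc 0 M, ENNReal.ofReal c ^ n :=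
          Finset.sum_le_sum fun a _ => Finset.sum_le_sum fun b _ => hb a b
      _ = ENNReal.ofReal (C * c ^ n) := by
          rw [Finset.sum_const, Finset.sum_const, nsmul_eq_mul, nsmul_eq_mul,
            ENNReal.ofReal_mul hC.le, ENNReal.ofReal_pow hc0.le,
            ENNReal.ofReal_mul (Nat.cast_nonneg _), ENNReal.ofReal_natCast, mul_assoc]
  have hkey : ∀ n : ℕ, -(2 * lam * M) - μ * (n * α) ≤ Real.log C + n * Real.log c := by
    intro n
    have hexp_int : Integrable (fun ω => Real.exp (Y n ω)) P := by
      refine ⟨Real.continuous_exp.comp_aestronglyMeasurable (hY_int n).1, ?_⟩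
      rw [hasFiniteIntegral_iff_ofReal (ae_of_all _ fun ω => (Real.exp_pos _).le)]
      exact (hlint n).trans_lt ENNReal.ofReal_lt_top
    have hjensen : Real.exp (∫ ω, Y n ω ∂P) ≤ ∫ ω, Real.exp (Y n ω) ∂P :=
      convexOn_exp.map_integral_le Real.continuous_exp.continuousOn isClosed_univ
        (ae_of_all _ fun _ => mem_univ _) (hY_int n) hexp_int
    have hint : ∫ ω, Real.exp (Y n ω) ∂P ≤ C * c ^ n := by
      rw [integral_eq_lintegral_of_nonneg_ae (ae_of_all _ fun ω => (Real.exp_pos _).le)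
        hexp_int.1]
      exact ENNReal.toReal_le_of_le_ofReal (by positivity) (hlint n)
    have := hjensen.trans hint
    rw [← Real.le_log_iff_exp_le (by positivity), hY_eq, Real.log_mul hC.ne' (by positivity),
      Real.log_pow] at this
    exact this
  have hlogc : Real.log c = Real.log (p lam μ) - lam * (F - 2) + Real.log β.toReal := by
    simp only [c]
    rw [Real.log_mul (by positivity) hβpos.ne', Real.log_mul hp.ne' (Real.exp_pos _).ne',
      Real.log_exp]
    ring
  have hfinal : -(μ * α) - Real.log c ≤ 0 :=
    nonpos_of_forall_nat_mul_le (K := Real.log C + 2 * lam * M) fun n => by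
      linarith [hkey n, show (n : ℝ) * (-(μ * α) - Real.log c)
        = -(μ * (n * α)) - n * Real.log c by ring]
  rw [one_div, inv_mul_le_iff₀ hμ0]
  linarith

end VelocityBound

/-! ### The rate function `W` -/

section RateFunction

variable {lam β : ℝ}

theorem one_le_p {μ : ℝ} (hlam : 0 < lam) (hμ : lam < μ) : 1 ≤ p lam μ := by
  have h1 : Real.exp (-lam) < 1 := Real.exp_lt_one_iff.2 (by linarith)
  have h2 : Real.exp (lam - μ) < 1 := Real.exp_lt_one_iff.2 (by linarith)
  have h3 : 1 ≤ 1 / (1 - Real.exp (-lam)) := by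
    rw [le_div_iff₀ (by linarith)]
    linarith [Real.exp_pos (-lam)]
  have h4 : 0 ≤ 1 / (1 - Real.exp (lam - μ)) := one_div_nonneg.2 (by linarith)
  unfold p
  linarith

theorem p_antitone {μ μ' : ℝ} (hμ : lam < μ) (hμμ' : μ ≤ μ') : p lam μ' ≤ p lam μ := by
  have h2 : Real.exp (lam - μ) < 1 := Real.exp_lt_one_iff.2 (by linarith)
  have h3 : Real.exp (lam - μ') ≤ Real.exp (lam - μ) := Real.exp_le_exp.2 (by linarith)
  unfold p
  gcongr

/-- Both logarithms are nonnegative and `lam / μ < 1`, so `|F - 2|` dominates. Without boundedness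
the real supremum would take a default value. -/
theorem bddAbove_range_W (hlam : 0 < lam) (hβ : 1 ≤ β) (F : ℝ) :
    BddAbove (range fun μ : Ioi lam =>
      1 / (μ : ℝ) * (lam * (F - 2) - Real.log (p lam (μ : ℝ)) - Real.log β)) := by
  refine ⟨|F - 2|, ?_⟩
  rintro _ ⟨⟨μ, hμ⟩, rfl⟩
  have hμ' : lam < μ := hμ
  have h1 := Real.log_nonneg (one_le_p hlam hμ')
  have h2 := Real.log_nonneg hβ
  have h3 := le_abs_self (F - 2)
  have h4 := abs_nonneg (F - 2)
  simp only
  rw [one_div, inv_mul_le_iff₀ (hlam.trans hμ')]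
  nlinarith

theorem le_W (hlam : 0 < lam) (hβ : 1 ≤ β) (F : ℝ) {μ : ℝ} (hμ : lam < μ) :
    1 / μ * (lam * (F - 2) - Real.log (p lam μ) - Real.log β) ≤ W lam β F :=
  le_ciSup (bddAbove_range_W hlam hβ F) ⟨μ, hμ⟩

theorem W_monotone (hlam : 0 < lam) (hβ : 1 ≤ β) : Monotone (W lam β) := by
  intro F F' hFF'
  refine ciSup_mono (bddAbove_range_W hlam hβ F') ?_
  rintro ⟨μ, hμ⟩
  have : 0 < μ := hlam.trans hμ
  simp only
  gcongr

/-- As `μ → ∞` the prefactor `1 / μ` tends to zero while the bracket stays bounded below, because `p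
lam` decreases in `μ`. -/
theorem W_nonneg (hlam : 0 < lam) (hβ : 1 ≤ β) (F : ℝ) : 0 ≤ W lam β F := by
  let K := lam * (F - 2) - Real.log (p lam (lam + 1)) - Real.log β
  have hlim : Tendsto (fun n : ℕ => 1 / ((n : ℝ) + (lam + 1)) * K) atTop (𝓝 (0 * K)) := by
    refine Tendsto.mul_const K ?_
    simp only [one_div]
    exact tendsto_inv_atTop_zero.comp
      (tendsto_atTop_add_const_right _ _ tendsto_natCast_atTop_atTop)
  rw [zero_mul] at hlim
  refine le_of_tendsto' hlim fun n => ?_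
  have hn : (0 : ℝ) ≤ n := n.cast_nonneg
  refine le_trans ?_ (le_W hlam hβ F (μ := n + (lam + 1)) (by linarith))
  have hlog : Real.log (p lam (n + (lam + 1))) ≤ Real.log (p lam (lam + 1)) :=
    Real.log_le_log (p_pos hlam (by linarith)) (p_antitone (by linarith) (by linarith))
  simp only [K]
  gcongr

theorem exists_W_pos (hlam : 0 < lam) (hβ : 1 ≤ β) : ∃ F, 0 ≤ F ∧ 0 < W lam β F := by
  have h1 := Real.log_nonneg (one_le_p hlam (lt_add_one lam))
  have h2 := Real.log_nonneg hβ
  -- This `F` makes the bracket equal to `1` at `μ = lam + 1`.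
  refine ⟨2 + (Real.log (p lam (lam + 1)) + Real.log β + 1) / lam, by positivity, ?_⟩
  refine lt_of_lt_of_le ?_ (le_W hlam hβ _ (lt_add_one lam))
  rw [add_sub_cancel_left, mul_div_cancel₀ _ hlam.ne']
  refine mul_pos (by positivity) ?_
  linarith

end RateFunction

/-! ### Mean heights and right derivatives -/

section MeanHeight

variable {Ω E : Type*} [MeasurableSpace Ω] [MeasurableSpace E] {P : Measure Ω}
  [IsProbabilityMeasure P] {ev : E → ℝ → ℝ} {f : ℤ → Ω → E} {F : ℝ} {U : Ω → Heights}

theorem integrable_height (hF : 0 ≤ F) (hev : ∀ e y, 0 ≤ ev e y) (hf : ∀ i, Measurable (f i))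
    (hU : Measurable U)
    (hsol : ∀ᵐ ω ∂P, IsSolution F (fun i => ev (f i ω)) fun i t => U ω i t)
    (hstat : JointlyStationary P f U) {t : ℝ} (ht : 0 ≤ t) (i : ℤ) :
    Integrable (fun ω => U ω i t) P := by
  refine Integrable.of_bound (C := F * t) (measurable_height hU i t).aestronglyMeasurable ?_
  filter_upwards [hsol, ae_height_le hF hev hf hU hsol hstat ht] with ω h1 h2
  rw [Real.norm_of_nonneg (h1.nonneg i ht)]
  exact h2 i

/-- A lower bound for the mean velocity at all times is one for mean increments of the height. -/
theorem mul_le_integral_height_sub (hF : 0 ≤ F)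
    (hev_meas : Measurable fun q : E × ℝ => ev q.1 q.2)
    (hev : ∀ e y, 0 ≤ ev e y) (hf : ∀ i, Measurable (f i)) (hU : Measurable U)
    (hsol : ∀ᵐ ω ∂P, IsSolution F (fun i => ev (f i ω)) fun i t => U ω i t)
    (hstat : JointlyStationary P f U) {w : ℝ} (hw : 0 ≤ w)
    (hvel : ∀ t, 0 ≤ t →
      w ≤ ∫ ω, velocity F (fun i => ev (f i ω)) (fun i s => U ω i s) 0 t ∂P)
    {s t : ℝ} (hs : 0 ≤ s) (hst : s ≤ t) :
    w * (t - s) ≤ ∫ ω, (U ω 0 t - U ω 0 s) ∂P := by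
  have ht : 0 ≤ t := hs.trans hst
  let V : Ω → ℝ → ℝ := fun ω r => velocity F (fun i => ev (f i ω)) (fun i s => U ω i s) 0 r
  have hVm : Measurable fun q : Ω × ℝ => ENNReal.ofReal (V q.1 q.2) :=
    (measurable_velocity_comp hev_meas hf hU 0).ennreal_ofReal
  have hincr : ∀ᵐ ω ∂P, ENNReal.ofReal (U ω 0 t - U ω 0 s)
      = ∫⁻ r in Ioc s t, ENNReal.ofReal (V ω r) := by
    filter_upwards [hsol] with ω hω
    rw [hω.sub_eq 0 hs ht, intervalIntegral.integral_of_le hst]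
    exact ofReal_integral_eq_lintegral_ofReal
      ((intervalIntegrable_iff_integrableOn_Ioc_of_le hst).1 (hω.intervalIntegrable 0 hs ht))
      (ae_of_all _ fun r => velocity_nonneg _ _)
  have hnonneg : ∀ᵐ ω ∂P, 0 ≤ U ω 0 t - U ω 0 s := by
    filter_upwards [hsol] with ω hω
    exact sub_nonneg.2 (hω.monotoneOn 0 hs ht hst)
  have hint : Integrable (fun ω => U ω 0 t - U ω 0 s) P :=
    (integrable_height hF hev hf hU hsol hstat ht 0).sub
      (integrable_height hF hev hf hU hsol hstat hs 0)
  have hle : ENNReal.ofReal (w * (t - s))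
      ≤ ENNReal.ofReal (∫ ω, (U ω 0 t - U ω 0 s) ∂P) := by
    calc ENNReal.ofReal (w * (t - s)) = ∫⁻ _ in Ioc s t, ENNReal.ofReal w := by
          rw [setLIntegral_const, Real.volume_Ioc, ENNReal.ofReal_mul hw]
      _ ≤ ∫⁻ r in Ioc s t, ∫⁻ ω, ENNReal.ofReal (V ω r) ∂P := by
          refine setLIntegral_mono' measurableSet_Ioc fun r hr => ?_
          have hr0 : 0 ≤ r := hs.trans hr.1.le
          rw [← ofReal_integral_eq_lintegral_ofReal
            (integrable_velocity hF hev_meas hev hf hU hsol hstat hr0 0)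
            (ae_of_all _ fun ω => velocity_nonneg _ _)]
          exact ENNReal.ofReal_le_ofReal (hvel r hr0)
      -- Tonelli, which needs the joint measurability of the velocity in `ω` and time.
      _ = ∫⁻ ω, (∫⁻ r in Ioc s t, ENNReal.ofReal (V ω r)) ∂P :=
          (lintegral_lintegral_swap hVm.aemeasurable).symm
      _ = ∫⁻ ω, ENNReal.ofReal (U ω 0 t - U ω 0 s) ∂P :=
          (lintegral_congr_ae hincr).symm
      _ = ENNReal.ofReal (∫ ω, (U ω 0 t - U ω 0 s) ∂P) :=
          (ofReal_integral_eq_lintegral_ofReal hint hnonneg).symm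
  exact (ENNReal.ofReal_le_ofReal_iff (integral_nonneg_of_ae hnonneg)).1 hle

/-- At the given time the right derivative need not equal the velocity, as the obstacle may be
discontinuous. The bound is inherited from mean increments by dominated convergence of difference
quotients, bounded through the velocity bound on `[0, t + 1]`. -/
theorem integrable_rightDeriv_and_le (hF : 0 ≤ F)
    (hev_meas : Measurable fun q : E × ℝ => ev q.1 q.2)
    (hev : ∀ e y, 0 ≤ ev e y) (hf : ∀ i, Measurable (f i)) (hU : Measurable U)
    (hsol : ∀ᵐ ω ∂P, IsSolution F (fun i => ev (f i ω)) fun i t => U ω i t)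
    (hstat : JointlyStationary P f U) {w : ℝ} (hw : 0 ≤ w)
    (hvel : ∀ t, 0 ≤ t →
      w ≤ ∫ ω, velocity F (fun i => ev (f i ω)) (fun i s => U ω i s) 0 t ∂P)
    {t : ℝ} (ht : 0 ≤ t) {D : Ω → ℝ}
    (hD : ∀ᵐ ω ∂P, HasDerivWithinAt (fun s => U ω 0 s) (D ω) (Ici t) t) :
    Integrable D P ∧ w ≤ ∫ ω, D ω ∂P := by
  let δ : ℕ → ℝ := fun n => 1 / ((n : ℝ) + 1)
  have hδ : ∀ n, 0 < δ n := fun n => by positivity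
  have hδ1 : ∀ n, δ n ≤ 1 := fun n => by
    simp only [δ]
    rw [div_le_one (by positivity)]
    linarith [(n.cast_nonneg : (0 : ℝ) ≤ n)]
  let Q : ℕ → Ω → ℝ := fun n ω => (δ n)⁻¹ * (U ω 0 (t + δ n) - U ω 0 t)
  have hQm : ∀ n, Measurable (Q n) := fun n =>
    ((measurable_height hU 0 _).sub (measurable_height hU 0 _)).const_mul _
  have hlim : ∀ᵐ ω ∂P, Tendsto (fun n => Q n ω) atTop (𝓝 (D ω)) := by
    filter_upwards [hD] with ω hω
    have hslope := (hasDerivWithinAt_iff_tendsto_slope' (by simp)).1 hω.Ioi_of_Ici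
    have hseq : Tendsto (fun n => t + δ n) atTop (𝓝[>] t) := by
      refine tendsto_nhdsWithin_iff.2 ⟨?_, Eventually.of_forall fun n => ?_⟩
      · simpa [δ] using tendsto_one_div_add_atTop_nhds_zero_nat.const_add t
      · exact mem_Ioi.2 (by linarith [hδ n])
    refine (hslope.comp hseq).congr fun n => ?_
    simp [Q, slope_def_field, div_eq_inv_mul]
  let B := 2 * (F * (t + 1)) + F
  have hbound : ∀ n, ∀ᵐ ω ∂P, ‖Q n ω‖ ≤ B := by
    intro n
    filter_upwards [hsol, ae_velocity_le hF hev hf hU hsol hstat (add_nonneg ht zero_le_one)]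
      with ω hω hv
    have h0 : 0 ≤ t + δ n := add_nonneg ht (hδ n).le
    have hle : t ≤ t + δ n := by linarith [hδ n]
    have hmono : 0 ≤ U ω 0 (t + δ n) - U ω 0 t := sub_nonneg.2 (hω.monotoneOn 0 ht h0 hle)
    have hQ0 : 0 ≤ Q n ω := mul_nonneg (inv_nonneg.2 (hδ n).le) hmono
    rw [Real.norm_of_nonneg hQ0]
    simp only [Q]
    rw [inv_mul_le_iff₀ (hδ n), hω.sub_eq 0 ht h0]
    calc ∫ r in t..t + δ n, velocity F (fun i => ev (f i ω)) (fun i s => U ω i s) 0 r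
        ≤ ∫ _ in t..t + δ n, B := by
          refine intervalIntegral.integral_mono_on hle (hω.intervalIntegrable 0 ht h0) (by simp)
            fun r hr => hv 0 r ⟨ht.trans hr.1, hr.2.trans (by linarith [hδ1 n])⟩
      _ = δ n * B := by simp
  have hDm : AEStronglyMeasurable D P :=
    aestronglyMeasurable_of_tendsto_ae atTop (fun n => (hQm n).aestronglyMeasurable) hlim
  have hDint : Integrable D P := by
    refine Integrable.of_bound (C := B) hDm ?_
    filter_upwards [hlim, ae_all_iff.2 hbound] with ω h1 h2
    exact le_of_tendsto' h1.norm h2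
  refine ⟨hDint, ?_⟩
  have hconv : Tendsto (fun n => ∫ ω, Q n ω ∂P) atTop (𝓝 (∫ ω, D ω ∂P)) :=
    tendsto_integral_of_dominated_convergence (fun _ => B)
      (fun n => (hQm n).aestronglyMeasurable) (integrable_const B) hbound hlim
  refine ge_of_tendsto' hconv fun n => ?_
  have := mul_le_integral_height_sub hF hev_meas hev hf hU hsol hstat hw hvel ht
    (show t ≤ t + δ n by linarith [hδ n])
  simp only [Q]
  rw [integral_const_mul, le_inv_mul_iff₀ (hδ n), mul_comm]
  simpa using this

end MeanHeight

end FrontModel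

end

/-! ### The theorem, transferred from the measurable version to the given solution -/

theorem theorem2
    {Ω : Type*} [MeasurableSpace Ω] (P : Measure Ω) [IsProbabilityMeasure P]
    -- a measurable space of nonnegative functions on the line with jointly measurable evaluation
    {E : Type*} [MeasurableSpace E] (ev : E → ℝ → ℝ)
    (hev_meas : Measurable fun q : E × ℝ => ev q.1 q.2)
    (hev_nonneg : ∀ e y, 0 ≤ ev e y)
    -- iid random functions with values in that space
    (f : ℤ → Ω → E) (hf_meas : ∀ i, Measurable (f i))
    (hf_indep : iIndepFun f P) (hf_ident : ∀ i, IdentDistrib (f i) (f 0) P P)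
    (hf_bdd : ∀ᵐ ω ∂P, ∀ a b : ℝ, BddAbove (ev (f 0 ω) '' Icc a b))
    -- finite exponential moment, uniformly over unit windows
    (lam : ℝ) (hlam : 0 < lam) (β : ℝ≥0∞)
    (hβ : β = FrontModel.windowMoment P lam fun ω => ev (f 0 ω)) (hβ_fin : β < ∞) :
    MonotoneOn (FrontModel.W lam β.toReal) (Ici 0) ∧
    (∀ F, 0 ≤ F → 0 ≤ FrontModel.W lam β.toReal F) ∧
    (∃ F, 0 ≤ F ∧ FrontModel.W lam β.toReal F ≠ 0) ∧
    ∀ F : ℝ, 0 ≤ F → ∀ u : ℤ → ℝ → Ω → ℝ,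
      (∀ i t, 0 ≤ t → AEMeasurable (u i t) P) →
      (∀ᵐ ω ∂P, FrontModel.IsUniqueSolution F (fun i => ev (f i ω)) fun i t => u i t ω) →
      -- the velocity given by the evolution equation
      (∀ t, 0 ≤ t →
        Integrable
          (fun ω => FrontModel.velocity F (fun i => ev (f i ω)) (fun i s => u i s ω) 0 t) P ∧
        FrontModel.W lam β.toReal F ≤
          ∫ ω, FrontModel.velocity F (fun i => ev (f i ω)) (fun i s => u i s ω) 0 t ∂P) ∧
      -- the (right) time derivative, at every time at which it exists almost surely
      (∀ t, 0 ≤ t → ∀ D : Ω → ℝ,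
        (∀ᵐ ω ∂P, HasDerivWithinAt (fun s => u 0 s ω) (D ω) (Ici t) t) →
        Integrable D P ∧ FrontModel.W lam β.toReal F ≤ ∫ ω, D ω ∂P) ∧
      -- the mean height
      (∀ t, 0 < t →
        Integrable (fun ω => u 0 t ω / t) P ∧
        FrontModel.W lam β.toReal F ≤ ∫ ω, u 0 t ω / t ∂P) := by
  subst hβ
  have hβ1 : 1 ≤ (FrontModel.windowMoment P lam fun ω => ev (f 0 ω)).toReal := by
    have h1 := FrontModel.one_le_windowMoment (P := P) (h := fun ω => ev (f 0 ω))
      (fun ω y => hev_nonneg _ y) hlam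
    simpa using ENNReal.toReal_mono hβ_fin.ne h1
  have hW := FrontModel.W_nonneg hlam hβ1
  obtain ⟨F₀, hF₀, hWF₀⟩ := FrontModel.exists_W_pos hlam hβ1
  refine ⟨(FrontModel.W_monotone hlam hβ1).monotoneOn _, fun F _ => hW F,
    ⟨F₀, hF₀, hWF₀.ne'⟩, fun F hF u _ hu => ?_⟩
  obtain ⟨U, hU, hsolU, hstat⟩ := FrontModel.exists_measurable_stationary_solution
    hev_meas hf_meas hf_indep hf_ident hu
  have hsol := hsolU.mono fun ω h => h.1
  have huU : ∀ᵐ ω ∂P, ∀ i t, 0 ≤ t → u i t ω = U ω i t := hsolU.mono fun ω h => h.2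
  have hvel : ∀ t, 0 ≤ t → FrontModel.W lam
      (FrontModel.windowMoment P lam fun ω => ev (f 0 ω)).toReal F ≤
      ∫ ω, FrontModel.velocity F (fun i => ev (f i ω)) (fun i s => U ω i s) 0 t ∂P := by
    intro t ht
    refine ciSup_le fun μ => ?_
    exact FrontModel.exponent_le_integral_velocity hF hev_meas hev_nonneg hf_meas hf_indep
      hf_ident hU hsol hstat hlam μ.2 hβ_fin ht
  refine ⟨fun t ht => ?_, fun t ht D hD => ?_, fun t ht => ?_⟩
  · have hae : (fun ω => FrontModel.velocity F (fun i => ev (f i ω)) (fun i s => U ω i s) 0 t)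
        =ᵐ[P] fun ω => FrontModel.velocity F (fun i => ev (f i ω)) (fun i s => u i s ω) 0 t := by
      filter_upwards [huU] with ω hω
      exact FrontModel.velocity_congr (fun i => (hω i t ht).symm) 0
    refine ⟨(FrontModel.integrable_velocity hF hev_meas hev_nonneg hf_meas hU hsol hstat
      ht 0).congr hae, ?_⟩
    rw [← integral_congr_ae hae]
    exact hvel t ht
  · refine FrontModel.integrable_rightDeriv_and_le hF hev_meas hev_nonneg hf_meas hU hsol hstat
      (hW F) hvel ht ?_
    filter_upwards [hD, huU] with ω h1 h2
    exact h1.congr (fun s hs => (h2 0 s (ht.trans hs)).symm) (h2 0 t ht).symm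
  · have hae : (fun ω => U ω 0 t / t) =ᵐ[P] fun ω => u 0 t ω / t := by
      filter_upwards [huU] with ω hω
      rw [hω 0 t ht.le]
    refine ⟨((FrontModel.integrable_height hF hev_nonneg hf_meas hU hsol hstat
      ht.le 0).div_const t).congr hae, ?_⟩
    rw [← integral_congr_ae hae, integral_div, le_div_iff₀ ht]
    have hincr := FrontModel.mul_le_integral_height_sub hF hev_meas hev_nonneg hf_meas hU hsol
      hstat (hW F) hvel le_rfl ht.le
    have h0 : (fun ω => U ω 0 t - U ω 0 0) =ᵐ[P] fun ω => U ω 0 t := by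
      filter_upwards [hsol] with ω hω
      rw [hω.initial 0, sub_zero]
    rwa [integral_congr_ae h0, sub_zero] at hincr
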